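/- Let $r(t)=\operatorname{sign}\sin(2\pi t)$ and $r_k(t)=r(2^kt)$, $k\ge 0$. For $n=\sum_\nu\varepsilon_\nu2^\nu$ with $\varepsilon_\nu\in\{0,1\}$ let $w_n=\prod_{\nu:\,\varepsilon_\nu=1}r_\nu$ be the Walsh functions in the Paley enumeration ($w_0=1$). Put $Vf(t)=\int_0^tf(s)\,ds$, $W_0f(t)=f(2t)$, $W_1f(t)=r(t)f(2t)$, and let $\rho_m=(4VW_1)^m1$ for $m\ge1$. Consider the system of functions $$\rho_m(2^{k+1}t)\,w_n(t),\qquad k=0,1,\dots,\quad n=2^k,\dots,2^{k+1}-1, \tag{$*$}$$ and the sequence $(v_{m,n})_{n\ge0}$ in the (real or complex) space $L^2(0,1)$ that consists of $v_{m,0}=1$ and of the functions $v_{m,n}(t)=\rho_m(2^{k+1}t)w_n(t)$ of the system $(*)$, $n\ge1$, $2^k\le n<2^{k+1}$. A sequence $(v_n)_{n\ge0}$ in a Hilbert space $H$ is called a Riesz basis if there are an orthonormal basis $(e_n)_{n\ge0}$ of $H$ and a bounded linear operator $T:H\to H$ with bounded inverse such that $v_n=Te_n$ for all $n$. Numbers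 $0<A\le B$ are called Riesz bounds of $(v_n)_{n\ge0}$ if for every $c\in\ell^2$ the series $\sum_nc_nv_n$ converges (unconditionally) and $A\|c\|_2\le\bigl\|\sum_nc_nv_n\bigr\|\le B\|c\|_2$. Then: 1. For every $m\ge3$ the system $(*)$ together with the function $1$, that is, the sequence $(v_{m,n})_{n\ge0}$, is a Riesz basis of $L^2(0,1)$. 2. There are $0<A\le B$, independent of $m$, that are Riesz bounds of $(v_{m,n})_{n\ge0}$ for every $m\ge1$. 3. For every $m\ge1$ there is a $1$-periodic function $\psi_m:\mathbb R\to\mathbb R$ of class $C^{m-1}$ with $\psi_m^{(m)}(t)=2^{m(m+5)/2}\prod_{k=0}^mr_k(t)$ for $t\notin2^{-(m+1)}\mathbb Z$ and $\psi_m^{(\mu)}(0)=0$ for $0\le\mu\le m-1$. For every such function the system $(*)$ coincides with the affine Walsh system $W^\alpha\psi_m=W_{\alpha_0}\cdots W_{\alpha_{k-1}}\psi_m$ generated by it, where $\alpha$ runs through all finite words in $0,1$ (including the empty word): the map $\alpha=(\alpha_0,\dots,\alpha_{k-1})\mapsto n=\sum_{\nu<k}\alpha_\nu2^\nu+2^k$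 is a bijection onto $\{1,2,\dots\}$, and $W^\alpha\psi_m(t)=\rho_m(2^{k+1}t)w_n(t)$ for all $t\in\mathbb R$. -/

import Mathlib

open MeasureTheory

noncomputable section

namespace WalshWavelet

/-! ### Rademacher and Walsh functions -/

/-- `r(t) = sign (sin (2 π t))`. -/
def rad (t : ℝ) : ℝ := Real.sign (Real.sin (2 * Real.pi * t))

/-- The Rademacher functions `r_k(t) = r(2^k t)`. -/
def rademacher (k : ℕ) (t : ℝ) : ℝ := rad (2 ^ k * t)

/-- The Walsh functions in the Paley enumeration: `w_n` is the product of the `r_ν` over the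
positions `ν` of the binary digits of `n` that are equal to `1`; in particular `w_0 = 1`. -/
def walsh (n : ℕ) (t : ℝ) : ℝ :=
  ∏ ν ∈ Finset.range n.size, if n.testBit ν then rademacher ν t else 1

/-! ### Operators -/

/-- The Volterra operator `V f(t) = ∫_0^t f(s) ds`. -/
def volterra (f : ℝ → ℝ) (t : ℝ) : ℝ := ∫ s in (0 : ℝ)..t, f s

/-- Dilation `W_0 f(t) = f(2t)` (for `false`) and
dilation-modulation `W_1 f(t) = r(t) f(2t)` (for `true`). -/
def opW : Bool → (ℝ → ℝ) → ℝ → ℝ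
  | false, f => fun t => f (2 * t)
  | true, f => fun t => rad t * f (2 * t)

/-- The products `W^α = W_{α_0} ⋯ W_{α_{k-1}}` for a finite 0-1 word `α`. -/
def opWord : List Bool → (ℝ → ℝ) → ℝ → ℝ
  | [], f => f
  | a :: α, f => opW a (opWord α f)

/-- The Paley number `∑_{ν < k} α_ν 2^ν + 2^k` of a 0-1 word `α` of length `k`. -/
def paleyNumber (α : List Bool) : ℕ :=
  (∑ ν : Fin α.length, (α.get ν).toNat * 2 ^ (ν : ℕ)) + 2 ^ α.length

/-- The operator `f ↦ 4 V W_1 f`. -/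
def opU (f : ℝ → ℝ) : ℝ → ℝ := fun t => 4 * volterra (opW true f) t

/-- `ρ_m = (4 V W_1)^m 1`. -/
def rho (m : ℕ) : ℝ → ℝ := opU^[m] (fun _ => 1)

/-- The constant function `1` (number `0`) and the functions `ρ_m(2^{k+1} t) w_n(t)` with
`k ≥ 0` and `2^k ≤ n < 2^{k+1}`, that is, `n ≥ 1` and `k = ⌊log₂ n⌋`. -/
def wavelet (m n : ℕ) (t : ℝ) : ℝ :=
  if n = 0 then 1 else rho m (2 ^ (Nat.log 2 n + 1) * t) * walsh n t

/-- `ψ` is the `1`-periodic spline of order `m ≥ 1` with knots in `2^{-(m+1)} ℤ`: it is of class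
`C^{m-1}`, its `m`-th derivative outside the knots is `2^{m(m+5)/2} ∏_{k=0}^m r_k`, and its
derivatives of the orders `0, …, m-1` vanish at `0`. -/
structure IsSpline (m : ℕ) (ψ : ℝ → ℝ) : Prop where
  periodic : Function.Periodic ψ 1
  contDiff : ContDiff ℝ ((m - 1 : ℕ) : WithTop ℕ∞) ψ
  deriv_eq : ∀ t : ℝ, (∀ j : ℤ, t ≠ j / 2 ^ (m + 1)) →
    HasDerivAt (iteratedDeriv (m - 1) ψ)
      (2 ^ (m * (m + 5) / 2) * ∏ k ∈ Finset.range (m + 1), rademacher k t) t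
  init_eq : ∀ μ < m, iteratedDeriv μ ψ 0 = 0

/-! ### Riesz bases and Riesz bounds -/

section Riesz

variable (𝕜 : Type*) [RCLike 𝕜] {H : Type*} [NormedAddCommGroup H] [InnerProductSpace 𝕜 H]

/-- A sequence is a Riesz basis if it is the image of an orthonormal basis under a bounded
linear operator with bounded inverse. -/
def IsRieszBasis (v : ℕ → H) : Prop :=
  ∃ (e : HilbertBasis ℕ 𝕜 H) (T : H ≃L[𝕜] H), ∀ n, v n = T (e n)

/-- `0 < A ≤ B` are Riesz bounds of `v` if for all `c ∈ ℓ²` the series `∑ c_n v_n` converges and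
`A ‖c‖₂ ≤ ‖∑ c_n v_n‖ ≤ B ‖c‖₂`. -/
def IsRieszBounds (A B : ℝ) (v : ℕ → H) : Prop :=
  0 < A ∧ A ≤ B ∧ ∀ c : lp (fun _ : ℕ => 𝕜) 2, ∃ s : H,
    HasSum (fun n => c n • v n) s ∧ A * ‖c‖ ≤ ‖s‖ ∧ ‖s‖ ≤ B * ‖c‖

end Riesz

/-! ### The system as a sequence in `L²(0,1)` -/

theorem measurable_rad : Measurable rad := by
  have h : Measurable Real.sign := by
    unfold Real.sign
    exact Measurable.ite measurableSet_Iio measurable_const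
      (Measurable.ite measurableSet_Ioi measurable_const measurable_const)
  exact h.comp (by fun_prop)

theorem abs_rad_le (t : ℝ) : |rad t| ≤ 1 := by
  unfold rad
  rcases Real.sign_apply_eq (Real.sin (2 * Real.pi * t)) with h | h | h <;> simp [h]

theorem continuous_rho (m : ℕ) : Continuous (rho m) := by
  induction m with
  | zero => exact continuous_const
  | succ m ih =>
    have hc : Continuous fun t : ℝ => rho m (2 * t) := by fun_prop
    have h : rho (m + 1) = fun t => 4 * volterra (opW true (rho m)) t := by
      unfold rho
      rw [Function.iterate_succ_apply']
      rfl
    rw [h]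
    refine continuous_const.mul (intervalIntegral.continuous_primitive (fun a b => ?_) 0)
    have hi := hc.intervalIntegrable (μ := volume) a b
    refine hi.mono_fun (measurable_rad.mul hc.measurable).aestronglyMeasurable
      (Filter.Eventually.of_forall fun t => ?_)
    simp only [opW, norm_mul, Real.norm_eq_abs]
    exact mul_le_of_le_one_left (abs_nonneg _) (abs_rad_le t)

theorem measurable_walsh (n : ℕ) : Measurable (walsh n) := by
  unfold walsh
  refine Finset.measurable_prod _ fun ν _ => ?_
  split_ifs
  · exact measurable_rad.comp (by fun_prop)
  · exact measurable_const

theorem abs_walsh_le (n : ℕ) (t : ℝ) : |walsh n t| ≤ 1 := by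
  unfold walsh
  rw [Finset.abs_prod]
  refine Finset.prod_le_one (fun _ _ => abs_nonneg _) fun ν _ => ?_
  split_ifs
  · exact abs_rad_le _
  · simp

theorem memLp_wavelet (𝕜 : Type*) [RCLike 𝕜] (m n : ℕ) :
    MemLp (fun t => ((wavelet m n t : ℝ) : 𝕜)) 2 (volume.restrict (Set.Ioo (0 : ℝ) 1)) := by
  by_cases hn : n = 0
  · simp only [wavelet, hn, if_true]
    exact memLp_const _
  have hc : Continuous fun t : ℝ => rho m (2 ^ (Nat.log 2 n + 1) * t) :=
    (continuous_rho m).comp (by fun_prop)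
  obtain ⟨C, hC⟩ := isCompact_Icc.exists_bound_of_continuousOn
    (hc.continuousOn (s := Set.Icc (0 : ℝ) 1))
  have hm : Measurable (wavelet m n) := by
    unfold wavelet
    simp only [hn, if_false]
    exact hc.measurable.mul (measurable_walsh n)
  refine MemLp.of_bound (RCLike.measurable_ofReal.comp hm).aestronglyMeasurable C ?_
  filter_upwards [ae_restrict_mem measurableSet_Ioo] with t ht
  have h1 := hC t ⟨ht.1.le, ht.2.le⟩
  rw [RCLike.norm_ofReal, wavelet, if_neg hn, abs_mul]
  exact (mul_le_of_le_one_right (abs_nonneg _) (abs_walsh_le n t)).trans h1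

/-- The sequence `wavelet m` in the real or complex Hilbert space `L²(0,1)`. -/
def waveletL2 (𝕜 : Type*) [RCLike 𝕜] (m n : ℕ) :
    Lp 𝕜 2 (volume.restrict (Set.Ioo (0 : ℝ) 1)) :=
  (memLp_wavelet 𝕜 m n).toLp _

end WalshWavelet

end

/-! Expand ρ_m in Walsh functions with coefficients c_m(p). Multiplying a dilated Walsh function by
w_n concatenates binary digits, so for n ≥ 1 the wavelet with number n is ∑_p c_m(p) w_{append n p},
and c_m(0) = 1. The system is thus the Walsh basis perturbed by the operator S with S w_0 = 0 and S
w_n = ∑_{p ≥ 1} c_m(p) w_{append n p}. If ‖S‖ ≤ 999/1000 for all m ≥ 1, then 1 + S is invertible by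
the Neumann series, and 1/1000 and 1999/1000 are common Riesz bounds.

To control c_m, the primitive of a Walsh function is expanded in Walsh functions (`hasSum_walsh`).
Integration by parts then turns ρ_{m+1} = 4 V W_1 ρ_m into the recursion `WalshStep`, whose leading
term is c_{m+1}(1 + 2(2^k + n)) ≈ -2^{-(k+1)} c_m(n). The estimates collected in `Admissible`
reproduce themselves under this recursion (`Admissible.step`), so they hold uniformly in m.

For the norm, c_{m+1} is split into its leading term `mainPart`, grouped by the position of the
second leading binary digit of p, and a remainder, grouped by the leading digit. Within one group
`append n p` determines n and p, so the group acts as an ℓ² norm times an isometry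
(`ShiftBound.of_injOn`). The group norms sum to less than 1 (`Admissible.sum_bounds_le`).

For the splines, V and W_1 commute up to the factor 1/2 on periodic functions of mean zero
(`volterra_opW`). Each differentiation of W_1 ρ_m therefore trades one V for a factor of 2 and lifts
another W_1 to the front, ending with W_1^{m+1} 1 = ∏ r_k. The initial conditions leave no other
spline (`IsSpline.unique`). -/

namespace WalshWavelet

/-! ### Elementary properties of the Rademacher and Walsh functions -/

theorem rad_periodic : Function.Periodic rad 1 := fun t => by
  unfold rad
  rw [mul_add, mul_one, Real.sin_add_two_pi]

theorem rad_neg (t : ℝ) : rad (-t) = -rad t := by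
  unfold rad
  rw [mul_neg, Real.sin_neg, Real.sign_neg]

theorem rad_add_half (t : ℝ) : rad (t + 1 / 2) = -rad t := by
  unfold rad
  rw [show 2 * Real.pi * (t + 1 / 2) = 2 * Real.pi * t + Real.pi by ring, Real.sin_add_pi,
    Real.sign_neg]

theorem rad_of_mem_Ioo {t : ℝ} (ht : t ∈ Set.Ioo (0 : ℝ) (1 / 2)) : rad t = 1 := by
  unfold rad
  refine Real.sign_of_pos (Real.sin_pos_of_pos_of_lt_pi ?_ ?_)
  · exact mul_pos Real.two_pi_pos ht.1
  · nlinarith [ht.2, Real.pi_pos]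

theorem rad_of_mem_Ioo' {t : ℝ} (ht : t ∈ Set.Ioo (1 / 2 : ℝ) 1) : rad t = -1 := by
  have h := rad_add_half (t - 1 / 2)
  rw [sub_add_cancel] at h
  rw [h, rad_of_mem_Ioo ⟨by linarith [ht.1], by linarith [ht.2]⟩]

theorem rad_zero : rad 0 = 0 := by simp [rad]

theorem rad_half : rad (1 / 2) = 0 := by
  have h := rad_add_half 0
  rw [zero_add, rad_zero, neg_zero] at h
  exact h

/-- The dyadic rationals, where Rademacher functions may vanish. -/
def dyadic : Set ℝ := {t | ∃ (k : ℕ) (j : ℤ), t = j / 2 ^ k}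

theorem countable_dyadic : dyadic.Countable := by
  have : dyadic = ⋃ k : ℕ, Set.range fun j : ℤ => (j : ℝ) / 2 ^ k := by
    ext t
    simp [dyadic, eq_comm]
  rw [this]
  exact Set.countable_iUnion fun k => Set.countable_range _

theorem ae_notMem_dyadic : ∀ᵐ t : ℝ, t ∉ dyadic :=
  countable_dyadic.ae_notMem _

theorem two_mul_notMem_dyadic {t : ℝ} (ht : t ∉ dyadic) : 2 * t ∉ dyadic := by
  rintro ⟨k, j, h⟩
  exact ht ⟨k + 1, j, by rw [pow_succ]; field_simp; field_simp at h; linarith⟩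

theorem rad_mul_self_of_ne {t : ℝ} (ht : ∀ j : ℤ, t ≠ j / 2) : rad t * rad t = 1 := by
  have h0 : Real.sin (2 * Real.pi * t) ≠ 0 := fun h => by
    obtain ⟨j, hj⟩ := Real.sin_eq_zero_iff.mp h
    refine ht j (mul_left_cancel₀ Real.pi_pos.ne' ?_)
    linarith
  unfold rad
  rcases Real.sign_apply_eq_of_ne_zero _ h0 with h | h <;> simp [h]

theorem rad_mul_self {t : ℝ} (ht : t ∉ dyadic) : rad t * rad t = 1 :=
  rad_mul_self_of_ne fun j hj => ht ⟨1, j, by simpa using hj⟩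

theorem rademacher_succ (k : ℕ) (t : ℝ) : rademacher (k + 1) t = rademacher k (2 * t) := by
  unfold rademacher
  rw [pow_succ, mul_assoc]

theorem rademacher_zero (t : ℝ) : rademacher 0 t = rad t := by simp [rademacher]

theorem walsh_zero : walsh 0 = fun _ => 1 := by
  ext t
  simp [walsh]

theorem walsh_eq_prod {n s : ℕ} (hs : n.size ≤ s) (t : ℝ) :
    walsh n t = ∏ ν ∈ Finset.range s, if n.testBit ν then rademacher ν t else 1 := by
  unfold walsh
  refine Finset.prod_subset (Finset.range_mono hs) fun ν _ hν => ?_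
  rw [if_neg]
  have : n < 2 ^ ν := Nat.size_le.mp (by simpa using hν)
  simp [Nat.testBit_lt_two_pow this]

/-- W_0 and W_1 prepend a lowest digit to the index; this is what makes induction on binary digits
available throughout. -/
theorem walsh_bit (a : Bool) (n : ℕ) : walsh (Nat.bit a n) = opW a (walsh n) := by
  ext t
  have hs : (Nat.bit a n).size ≤ n.size + 1 := by
    rw [Nat.size_le, pow_succ]
    have := Nat.lt_size_self n
    cases a <;> simp [Nat.bit] <;> omega
  rw [walsh_eq_prod hs, Finset.prod_range_succ']
  simp only [Nat.testBit_bit_succ, Nat.testBit_bit_zero, rademacher_succ, rademacher_zero]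
  cases a <;> simp [opW, walsh, mul_comm]

theorem walsh_one : walsh 1 = rad := by
  have := walsh_bit true 0
  rw [walsh_zero] at this
  rw [show (1 : ℕ) = Nat.bit true 0 from rfl, this]
  ext t
  simp [opW]

theorem opW_periodic {f : ℝ → ℝ} (a : Bool) (hf : Function.Periodic f 1) :
    Function.Periodic (opW a f) 1 := by
  intro t
  have h2 : f (2 * (t + 1)) = f (2 * t) := by
    rw [show 2 * (t + 1) = 2 * t + 1 + 1 by ring, hf, hf]
  cases a
  · exact h2
  · simp only [opW, h2, rad_periodic t]

theorem walsh_periodic (n : ℕ) : Function.Periodic (walsh n) 1 := by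
  induction n using Nat.binaryRec with
  | zero => simp [walsh_zero, Function.Periodic]
  | bit a n ih => rw [walsh_bit]; exact opW_periodic a ih

/-- Bounded measurable functions. -/
def BddMeas (f : ℝ → ℝ) : Prop := Measurable f ∧ ∃ C, ∀ t, |f t| ≤ C

namespace BddMeas

theorem intervalIntegrable {f : ℝ → ℝ} (hf : BddMeas f) (a b : ℝ) :
    IntervalIntegrable f volume a b := by
  obtain ⟨hm, C, hC⟩ := hf
  refine (intervalIntegrable_const (c := C)).mono_fun hm.aestronglyMeasurable
    (Filter.Eventually.of_forall fun t => ?_)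
  exact (hC t).trans (le_abs_self C)

theorem mul {f g : ℝ → ℝ} (hf : BddMeas f) (hg : BddMeas g) : BddMeas fun t => f t * g t := by
  obtain ⟨hm, C, hC⟩ := hf
  obtain ⟨hm', C', hC'⟩ := hg
  refine ⟨hm.mul hm', C * C', fun t => ?_⟩
  rw [abs_mul]
  exact mul_le_mul (hC t) (hC' t) (abs_nonneg _) ((abs_nonneg _).trans (hC t))

theorem comp_two_mul {f : ℝ → ℝ} (hf : BddMeas f) : BddMeas fun t => f (2 * t) :=
  ⟨hf.1.comp (by fun_prop), hf.2.imp fun _ h t => h (2 * t)⟩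

theorem rad : BddMeas rad := ⟨measurable_rad, 1, abs_rad_le⟩

theorem opW {f : ℝ → ℝ} (a : Bool) (hf : BddMeas f) : BddMeas (opW a f) := by
  cases a
  · exact hf.comp_two_mul
  · exact BddMeas.rad.mul hf.comp_two_mul

theorem walsh (n : ℕ) : BddMeas (walsh n) := ⟨measurable_walsh n, 1, abs_walsh_le n⟩

end BddMeas

/-! ### Integrals of W_a f and orthonormality of the Walsh functions. -/

theorem integral_opW_left (a : Bool) (f : ℝ → ℝ) {x : ℝ} (h0 : 0 ≤ x) (hx : x ≤ 1 / 2) :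
    ∫ t in (0 : ℝ)..x, opW a f t = 2⁻¹ * ∫ t in (0 : ℝ)..(2 * x), f t := by
  have : ∫ t in (0 : ℝ)..x, opW a f t = ∫ t in (0 : ℝ)..x, f (2 * t) := by
    refine intervalIntegral.integral_congr_Ioo_of_le h0 fun t ht => ?_
    cases a
    · rfl
    · simp only [opW]
      rw [rad_of_mem_Ioo ⟨ht.1, ht.2.trans_le hx⟩, one_mul]
  rw [this, intervalIntegral.integral_comp_mul_left _ two_ne_zero]
  simp

theorem integral_opW_right (a : Bool) (f : ℝ → ℝ) {x : ℝ} (h0 : 1 / 2 ≤ x) (hx : x ≤ 1) :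
    ∫ t in (1 / 2 : ℝ)..x, opW a f t =
      2⁻¹ * ((if a then -1 else 1) * ∫ t in (1 : ℝ)..(2 * x), f t) := by
  have : ∫ t in (1 / 2 : ℝ)..x, opW a f t =
      ∫ t in (1 / 2 : ℝ)..x, (if a then -1 else 1) * f (2 * t) := by
    refine intervalIntegral.integral_congr_Ioo_of_le h0 fun t ht => ?_
    cases a
    · simp [opW]
    · simp only [opW]
      rw [rad_of_mem_Ioo' ⟨ht.1, ht.2.trans_le hx⟩]
      simp
  rw [this, intervalIntegral.integral_const_mul,
    intervalIntegral.integral_comp_mul_left _ two_ne_zero]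
  simp

theorem integral_opW {f : ℝ → ℝ} (a : Bool) (hp : Function.Periodic f 1) (hf : BddMeas f) :
    ∫ t in (0 : ℝ)..1, opW a f t = if a then 0 else ∫ t in (0 : ℝ)..1, f t := by
  have h2 : ∫ t in (1 : ℝ)..(2 * 1), f t = ∫ t in (0 : ℝ)..1, f t := by
    have := hp.intervalIntegral_add_eq 1 0
    norm_num at this ⊢
    exact this
  rw [← intervalIntegral.integral_add_adjacent_intervals ((hf.opW a).intervalIntegrable 0 (1 / 2))
    ((hf.opW a).intervalIntegrable _ _), integral_opW_left a f (by norm_num) le_rfl,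
    integral_opW_right a f (by norm_num) le_rfl, h2]
  cases a <;> norm_num
  ring

theorem opW_mul_opW (a b : Bool) (f g : ℝ → ℝ) {t : ℝ} (ht : t ∉ dyadic) :
    opW a f t * opW b g t = opW (bne a b) (fun s => f s * g s) t := by
  have := rad_mul_self ht
  cases a <;> cases b <;> simp [opW]
  · ring
  · ring
  · linear_combination (f (2 * t) * g (2 * t)) * this

theorem integral_opW_mul_opW {f g : ℝ → ℝ} (a b : Bool) (hf : Function.Periodic f 1)
    (hg : Function.Periodic g 1) (hf' : BddMeas f) (hg' : BddMeas g) :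
    ∫ t in (0 : ℝ)..1, opW a f t * opW b g t =
      if a = b then ∫ t in (0 : ℝ)..1, f t * g t else 0 := by
  have : ∫ t in (0 : ℝ)..1, opW a f t * opW b g t =
      ∫ t in (0 : ℝ)..1, opW (bne a b) (fun s => f s * g s) t := by
    refine intervalIntegral.integral_congr_ae ?_
    filter_upwards [ae_notMem_dyadic] with t ht _
    exact opW_mul_opW a b f g ht
  rw [this, integral_opW (f := fun s => f s * g s) _ (hf.mul hg) (hf'.mul hg')]
  cases a <;> cases b <;> simp

/-- Walsh coefficients of a function on `(0,1)`. -/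
noncomputable def walshCoeff (f : ℝ → ℝ) (n : ℕ) : ℝ := ∫ t in (0 : ℝ)..1, f t * walsh n t

theorem walshCoeff_opW {f : ℝ → ℝ} (a b : Bool) (hf : Function.Periodic f 1) (hf' : BddMeas f)
    (n : ℕ) : walshCoeff (opW a f) (Nat.bit b n) = if a = b then walshCoeff f n else 0 := by
  unfold walshCoeff
  rw [walsh_bit, integral_opW_mul_opW a b hf (walsh_periodic n) hf' (BddMeas.walsh n)]

theorem walshCoeff_one (n : ℕ) : walshCoeff (fun _ => 1) n = if n = 0 then 1 else 0 := by
  induction n using Nat.binaryRec with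
  | zero => simp [walshCoeff, walsh_zero]
  | bit a n ih =>
    have h := walshCoeff_opW (f := fun _ => 1) false a (fun _ => rfl)
      ⟨measurable_const, 1, by simp⟩ n
    have h1 : opW false (fun _ => 1) = fun _ => 1 := rfl
    rw [h1] at h
    rw [h, ih]
    cases a <;> simp [Nat.bit]

theorem walshCoeff_walsh (m n : ℕ) : walshCoeff (walsh m) n = if m = n then 1 else 0 := by
  induction m using Nat.binaryRec generalizing n with
  | zero => rw [walsh_zero, walshCoeff_one]; simp [eq_comm]
  | bit a m ih =>
    obtain ⟨b, n, rfl⟩ : ∃ b n', n = Nat.bit b n' := ⟨n.bodd, n.div2, (Nat.bit_bodd_div2 n).symm⟩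
    rw [walsh_bit, walshCoeff_opW a b (walsh_periodic m) (BddMeas.walsh m), ih]
    cases a <;> cases b <;> simp [Nat.bit_val] <;> grind

/-! ### The functions `ρ_m` -/

theorem rho_succ (m : ℕ) (t : ℝ) : rho (m + 1) t = 4 * volterra (opW true (rho m)) t := by
  unfold rho
  rw [Function.iterate_succ_apply']
  rfl

theorem volterra_zero (f : ℝ → ℝ) : volterra f 0 = 0 := by simp [volterra]

theorem volterra_sub {f : ℝ → ℝ} (hf : BddMeas f) (a b : ℝ) :
    volterra f b - volterra f a = ∫ s in a..b, f s :=
  intervalIntegral.integral_interval_sub_left (hf.intervalIntegrable _ _)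
    (hf.intervalIntegrable _ _)

theorem BddMeas.of_continuous_of_periodic {f : ℝ → ℝ} (hc : Continuous f)
    (hp : Function.Periodic f 1) : BddMeas f := by
  obtain ⟨C, hC⟩ := isCompact_Icc.exists_bound_of_continuousOn (hc.continuousOn (s := Set.Icc 0 1))
  refine ⟨hc.measurable, C, fun t => ?_⟩
  obtain ⟨y, hy, h⟩ := hp.exists_mem_Ico₀ one_pos t
  rw [h]
  exact hC y ⟨hy.1, hy.2.le⟩

/-- W_1 ρ_m changes sign under a shift by 1/2, and its integral over (0, 1/2) is half the mean of
ρ_m. The symmetry gives both the period 1 and the mean 1 of the next function, which closes the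
induction in `rho_periodic_and_integral`. -/
theorem rho_succ_add_half {m : ℕ} (hp : Function.Periodic (rho m) 1)
    (hi : ∫ t in (0 : ℝ)..1, rho m t = 1) (t : ℝ) :
    rho (m + 1) (t + 1 / 2) = 2 - rho (m + 1) t := by
  have hb := (BddMeas.of_continuous_of_periodic (continuous_rho m) hp).opW true
  have h1 : volterra (opW true (rho m)) (1 / 2) = 1 / 2 := by
    unfold volterra
    rw [integral_opW_left _ _ (by norm_num) le_rfl]
    norm_num
    rw [hi]
  have h2 : ∫ s in (1 / 2 : ℝ)..(t + 1 / 2), opW true (rho m) s =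
      -volterra (opW true (rho m)) t := by
    have h := intervalIntegral.integral_comp_add_right (a := 0) (b := t)
      (opW true (rho m)) (1 / 2)
    rw [zero_add] at h
    rw [← h]
    unfold volterra
    rw [← intervalIntegral.integral_neg]
    refine intervalIntegral.integral_congr fun s _ => ?_
    simp only [opW]
    rw [rad_add_half, show 2 * (s + 1 / 2) = 2 * s + 1 by ring, hp]
    ring
  have h3 := volterra_sub hb (1 / 2) (t + 1 / 2)
  rw [rho_succ, rho_succ]
  linarith

theorem rho_periodic_and_integral (m : ℕ) :
    Function.Periodic (rho m) 1 ∧ ∫ t in (0 : ℝ)..1, rho m t = 1 := by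
  induction m with
  | zero => exact ⟨fun _ => rfl, by simp [rho]⟩
  | succ m ih =>
    have h := rho_succ_add_half ih.1 ih.2
    refine ⟨fun t => ?_, ?_⟩
    · rw [show t + 1 = t + 1 / 2 + 1 / 2 by ring, h, h]
      ring
    · have hc := continuous_rho (m + 1)
      have h2 := intervalIntegral.integral_comp_add_right (a := 0) (b := 1 / 2)
        (rho (m + 1)) (1 / 2)
      rw [← intervalIntegral.integral_add_adjacent_intervals (hc.intervalIntegrable 0 (1 / 2))
        (hc.intervalIntegrable _ _)]
      rw [zero_add, add_halves] at h2
      rw [← h2]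
      simp only [h]
      rw [intervalIntegral.integral_sub intervalIntegrable_const (hc.intervalIntegrable _ _)]
      norm_num

theorem rho_periodic (m : ℕ) : Function.Periodic (rho m) 1 := (rho_periodic_and_integral m).1

theorem BddMeas.rho (m : ℕ) : BddMeas (rho m) :=
  BddMeas.of_continuous_of_periodic (continuous_rho m) (rho_periodic m)

theorem rho_add_half (m : ℕ) (t : ℝ) : WalshWavelet.rho (m + 1) (t + 1 / 2) =
    2 - WalshWavelet.rho (m + 1) t :=
  rho_succ_add_half (rho_periodic m) (rho_periodic_and_integral m).2 t

theorem rho_neg (m : ℕ) (t : ℝ) : rho m (-t) = rho m t := by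
  induction m generalizing t with
  | zero => rfl
  | succ m ih =>
    rw [rho_succ, rho_succ]
    congr 1
    unfold volterra
    have h := intervalIntegral.integral_comp_neg (a := 0) (b := t) (opW true (rho m))
    rw [neg_zero] at h
    rw [intervalIntegral.integral_symm, ← h, ← intervalIntegral.integral_neg]
    refine intervalIntegral.integral_congr fun s _ => ?_
    simp only [opW]
    rw [rad_neg, mul_neg, ih]
    ring

theorem walshCoeff_rho_zero (m : ℕ) : walshCoeff (rho m) 0 = 1 := by
  unfold walshCoeff
  simp only [walsh_zero, mul_one]
  exact (rho_periodic_and_integral m).2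

theorem integral_eq_zero_of_odd {f : ℝ → ℝ} (hp : Function.Periodic f 1)
    (ho : ∀ t, f (-t) = -f t) : ∫ t in (0 : ℝ)..1, f t = 0 := by
  have h := intervalIntegral.integral_comp_neg (a := 0) (b := 1) f
  have h2 := hp.intervalIntegral_add_eq (-1) 0
  simp only [ho, intervalIntegral.integral_neg] at h
  norm_num at h h2
  linarith

theorem walsh_bit_neg {n : ℕ} {ε : ℝ} (a : Bool) (h : ∀ t, walsh n (-t) = ε * walsh n t) (t : ℝ) :
    walsh (Nat.bit a n) (-t) = (if a then -ε else ε) * walsh (Nat.bit a n) t := by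
  rw [walsh_bit]
  cases a
  · simp [opW, h]
  · simp [opW, h, rad_neg]
    ring

theorem walshCoeff_rho_one (m : ℕ) : walshCoeff (rho m) 1 = 0 := by
  refine integral_eq_zero_of_odd (fun t => ?_) fun t => ?_
  · simp only [rho_periodic m t, walsh_periodic 1 t]
  · rw [rho_neg, walsh_one, rad_neg, mul_neg]

/-- w_7 = r_0 r_1 r_2 is odd while ρ_m is even. This coefficient is what leaves no remainder on the
level 4 ≤ p < 8 in `Admissible.eq_mainPart`. -/
theorem walshCoeff_rho_seven (m : ℕ) : walshCoeff (rho m) 7 = 0 := by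
  refine integral_eq_zero_of_odd (fun t => ?_) fun t => ?_
  · simp only [rho_periodic m t, walsh_periodic 7 t]
  · have h0 : ∀ t, walsh 0 (-t) = 1 * walsh 0 t := by simp [walsh_zero]
    have h1 := walsh_bit_neg true (walsh_bit_neg true (walsh_bit_neg true h0)) t
    simp only [if_true, neg_neg] at h1
    rw [show Nat.bit true (Nat.bit true (Nat.bit true 0)) = 7 from rfl] at h1
    rw [rho_neg, h1]
    ring

/-! ### Primitives of Walsh functions -/

theorem volterra_periodic {f : ℝ → ℝ} (hp : Function.Periodic f 1) (hf : BddMeas f)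
    (hi : ∫ t in (0 : ℝ)..1, f t = 0) : Function.Periodic (volterra f) 1 := fun t => by
  have h := volterra_sub hf t (t + 1)
  rw [hp.intervalIntegral_add_eq t 0, zero_add, hi] at h
  linarith

theorem volterra_one_of_integral_eq_zero {f : ℝ → ℝ} (hi : ∫ t in (0 : ℝ)..1, f t = 0) :
    volterra f 1 = 0 := hi

/-- The factor 1/2 comes from the substitution s ↦ 2s. Mean zero makes V f vanish at all integers,
so the sign change of r at 1/2 and the zeros of r do no harm. -/
theorem volterra_opW {f : ℝ → ℝ} (a : Bool) (hp : Function.Periodic f 1) (hf : BddMeas f)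
    (hi : ∫ t in (0 : ℝ)..1, f t = 0) (t : ℝ) :
    volterra (opW a f) t = 2⁻¹ * opW a (volterra f) t := by
  have hV := volterra_periodic hp hf hi
  have hm : ∫ t in (0 : ℝ)..1, opW a f t = 0 := by
    rw [integral_opW a hp hf, hi, ite_self]
  have h1 := volterra_periodic (opW_periodic a hp) (hf.opW a) hm
  have h2 : Function.Periodic (fun t => 2⁻¹ * opW a (volterra f) t) 1 := fun t => by
    simp only [opW_periodic a hV t]
  have key : ∀ s ∈ Set.Ico (0 : ℝ) 1, volterra (opW a f) s = 2⁻¹ * opW a (volterra f) s := by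
    intro s hs
    have hleft : ∀ s : ℝ, 0 ≤ s → s ≤ 1 / 2 → volterra (opW a f) s = 2⁻¹ * volterra f (2 * s) :=
      fun s h0 hs => integral_opW_left a f h0 hs
    have hhalf : volterra (opW a f) (1 / 2) = 0 := by
      rw [hleft _ (by norm_num) le_rfl, mul_one_div_cancel two_ne_zero,
        volterra_one_of_integral_eq_zero hi, mul_zero]
    rcases lt_trichotomy s (1 / 2) with h | rfl | h
    · rw [hleft s hs.1 h.le]
      rcases hs.1.eq_or_lt with rfl | h0
      · cases a <;> simp [opW, volterra_zero]
      · cases a <;> simp [opW, rad_of_mem_Ioo ⟨h0, h⟩]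
    · rw [hhalf]
      cases a
      · simp [opW, volterra_one_of_integral_eq_zero hi]
      · simp only [opW]
        rw [rad_half, zero_mul, mul_zero]
    · have h3 := volterra_sub (hf.opW a) (1 / 2) s
      rw [hhalf, integral_opW_right a f h.le hs.2.le, ← volterra_sub hf,
        volterra_one_of_integral_eq_zero hi] at h3
      cases a
      · simp [opW] at h3 ⊢
        linarith
      · simp [opW, rad_of_mem_Ioo' ⟨h, hs.2⟩] at h3 ⊢
        linarith
  have h3 := key (Int.fract t) ⟨Int.fract_nonneg t, Int.fract_lt_one t⟩
  have e1 := h1.sub_int_mul_eq (x := t) ⌊t⌋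
  have e2 := h2.sub_int_mul_eq (x := t) ⌊t⌋
  rw [mul_one, Int.self_sub_floor] at e1 e2
  rw [← e1, ← e2, h3]

theorem opW_true_one : opW true (fun _ => 1) = rad := by
  ext t
  simp [opW]

theorem rho_one_eq (t : ℝ) : rho 1 t = 4 * volterra rad t := by
  rw [show (1 : ℕ) = 0 + 1 from rfl, rho_succ, ← opW_true_one]
  rfl

/-- `1 - 2 {t}`, with `{t}` the fractional part. -/
noncomputable def saw (t : ℝ) : ℝ := 1 - 2 * Int.fract t

theorem fract_mem_Ioo {t : ℝ} (ht : t ∉ dyadic) :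
    Int.fract t ∈ Set.Ioo (0 : ℝ) (1 / 2) ∨ Int.fract t ∈ Set.Ioo (1 / 2 : ℝ) 1 := by
  have h0 : Int.fract t ≠ 0 := fun h => ht ⟨0, ⌊t⌋, by
    have := Int.floor_add_fract t
    simp; linarith⟩
  have h1 : Int.fract t ≠ 1 / 2 := fun h => ht ⟨1, 2 * ⌊t⌋ + 1, by
    have := Int.floor_add_fract t
    push_cast; linarith⟩
  rcases lt_or_gt_of_ne h1 with h | h
  · exact Or.inl ⟨lt_of_le_of_ne (Int.fract_nonneg t) h0.symm, h⟩
  · exact Or.inr ⟨h, Int.fract_lt_one t⟩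

theorem rad_fract (t : ℝ) : rad (Int.fract t) = rad t := by
  have := rad_periodic.sub_int_mul_eq (x := t) ⌊t⌋
  rwa [mul_one, Int.self_sub_floor] at this

theorem fract_two_mul (t : ℝ) : Int.fract (2 * t) = Int.fract (2 * Int.fract t) := by
  conv_lhs => rw [← Int.floor_add_fract t]
  rw [show 2 * ((⌊t⌋ : ℝ) + Int.fract t) = ((2 * ⌊t⌋ : ℤ) : ℝ) + 2 * Int.fract t by push_cast; ring,
    Int.fract_intCast_add]

theorem fract_two_mul_of_lt {t : ℝ} (h : Int.fract t < 1 / 2) :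
    Int.fract (2 * t) = 2 * Int.fract t := by
  rw [fract_two_mul, Int.fract_eq_self]
  exact ⟨by linarith [Int.fract_nonneg t], by linarith⟩

theorem fract_two_mul_of_gt {t : ℝ} (h : 1 / 2 < Int.fract t) :
    Int.fract (2 * t) = 2 * Int.fract t - 1 := by
  rw [fract_two_mul, ← Int.fract_sub_one, Int.fract_eq_self]
  exact ⟨by linarith, by linarith [Int.fract_lt_one t]⟩

theorem saw_eq {t : ℝ} (ht : t ∉ dyadic) : saw t = 2⁻¹ * rad t + 2⁻¹ * saw (2 * t) := by
  unfold saw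
  rcases fract_mem_Ioo ht with h | h
  · rw [← rad_fract, rad_of_mem_Ioo h, fract_two_mul_of_lt h.2]; ring
  · rw [← rad_fract, rad_of_mem_Ioo' h, fract_two_mul_of_gt h.1]; ring

/-- Iteration of the self-similarity `saw_eq`; the bounded remainder carries the weight 2^{-K}. -/
theorem sum_rademacher_eq {t : ℝ} (ht : t ∉ dyadic) (K : ℕ) :
    ∑ k ∈ Finset.range K, (1 / 2 : ℝ) ^ (k + 1) * rademacher k t =
      saw t - (1 / 2) ^ K * saw (2 ^ K * t) := by
  induction K generalizing t with
  | zero => simp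
  | succ K ih =>
    rw [Finset.sum_range_succ']
    have h := ih (two_mul_notMem_dyadic ht)
    have h1 : ∑ k ∈ Finset.range K, (1 / 2 : ℝ) ^ (k + 1 + 1) * rademacher (k + 1) t =
        2⁻¹ * ∑ k ∈ Finset.range K, (1 / 2 : ℝ) ^ (k + 1) * rademacher k (2 * t) := by
      rw [Finset.mul_sum]
      refine Finset.sum_congr rfl fun k _ => ?_
      rw [rademacher_succ]
      ring
    rw [h1, h, saw_eq ht, rademacher_zero, pow_succ 2, mul_assoc]
    ring

theorem abs_saw_le (t : ℝ) : |saw t| ≤ 1 := by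
  unfold saw
  rw [abs_le]
  constructor <;> linarith [Int.fract_nonneg t, Int.fract_lt_one t]

theorem abs_rademacher_le (k : ℕ) (t : ℝ) : |rademacher k t| ≤ 1 := abs_rad_le _

theorem hasSum_rademacher {t : ℝ} (ht : t ∉ dyadic) :
    HasSum (fun k => (1 / 2 : ℝ) ^ (k + 1) * rademacher k t) (saw t) := by
  have hg : Summable fun k : ℕ => (1 / 2 : ℝ) ^ (k + 1) :=
    (summable_nat_add_iff 1).mpr summable_geometric_two
  have hs : Summable fun k => (1 / 2 : ℝ) ^ (k + 1) * rademacher k t := by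
    refine Summable.of_norm_bounded hg fun k => ?_
    rw [norm_mul, Real.norm_of_nonneg (by positivity)]
    exact mul_le_of_le_one_right (by positivity) (abs_rademacher_le k t)
  rw [hs.hasSum_iff_tendsto_nat]
  simp only [sum_rademacher_eq ht]
  have h0 : Filter.Tendsto (fun K : ℕ => (1 / 2 : ℝ) ^ K * saw (2 ^ K * t)) Filter.atTop
      (nhds 0) := by
    refine squeeze_zero_norm (fun K => ?_)
      (tendsto_pow_atTop_nhds_zero_of_lt_one (r := (1 / 2 : ℝ)) (by norm_num) (by norm_num))
    rw [norm_mul, Real.norm_of_nonneg (by positivity)]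
    exact mul_le_of_le_one_right (by positivity) (abs_saw_le _)
  simpa using h0.const_sub (saw t)

/-- ρ_1 is the tent function with peak 2 at 1/2. Together with the Rademacher expansion of the
sawtooth this is the case K = 0 of `hasSum_walsh`. -/
theorem one_sub_rho_one {t : ℝ} (ht : t ∉ dyadic) : 1 - rho 1 t = rad t * saw (2 * t) := by
  have hper := (rho_periodic 1).sub_int_mul_eq (x := t) ⌊t⌋
  rw [mul_one, Int.self_sub_floor] at hper
  have hleft : ∀ s : ℝ, 0 ≤ s → s ≤ 1 / 2 → rho 1 s = 4 * s := fun s h0 hs => by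
    rw [rho_one_eq, ← opW_true_one, volterra, integral_opW_left _ _ h0 hs]
    simp
  rw [← hper, ← rad_fract]
  unfold saw
  rcases fract_mem_Ioo ht with h | h
  · rw [hleft _ h.1.le h.2.le, rad_of_mem_Ioo h, fract_two_mul_of_lt h.2]; ring
  · have h2 := rho_add_half 0 (Int.fract t - 1 / 2)
    rw [sub_add_cancel, zero_add,
      hleft (Int.fract t - 1 / 2) (by linarith [h.1]) (by linarith [h.2])] at h2
    rw [h2, rad_of_mem_Ioo' h, fract_two_mul_of_gt h.1]; ring

theorem walsh_two_pow (k : ℕ) : walsh (2 ^ k) = rademacher k := by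
  induction k with
  | zero => ext t; rw [pow_zero, walsh_one, rademacher_zero]
  | succ k ih =>
    have : 2 ^ (k + 1) = Nat.bit false (2 ^ k) := by simp [Nat.bit_val, pow_succ, mul_comm]
    rw [this, walsh_bit, ih]
    ext t
    rw [rademacher_succ]
    rfl

theorem integral_walsh {n : ℕ} (hn : n ≠ 0) : ∫ t in (0 : ℝ)..1, walsh n t = 0 := by
  have h := walshCoeff_walsh n 0
  simpa [walshCoeff, walsh_zero, hn] using h

/-- Walsh expansion of the primitive of w_{2^K+n}: the leading term drops the top digit, all others
add a new one above it. In the induction each lower digit is pulled through V by `volterra_opW`, and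
its factor 1/2 is balanced by one more power of 2. -/
theorem hasSum_walsh {t : ℝ} (ht : t ∉ dyadic) (K : ℕ) {n : ℕ} (hn : n < 2 ^ K) :
    HasSum (fun i => (1 / 2 : ℝ) ^ (i + 1) * walsh (2 ^ K + n + 2 ^ (K + 1 + i)) t)
      (walsh n t - 2 ^ (K + 2) * volterra (walsh (2 ^ K + n)) t) := by
  induction K generalizing n t with
  | zero =>
    obtain rfl : n = 0 := by omega
    have h := (hasSum_rademacher (two_mul_notMem_dyadic ht)).mul_left (rad t)
    rw [← one_sub_rho_one ht, rho_one_eq] at h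
    have e : ∀ i, walsh (2 ^ 0 + 0 + 2 ^ (0 + 1 + i)) t = rad t * rademacher i (2 * t) := by
      intro i
      have : 2 ^ 0 + 0 + 2 ^ (0 + 1 + i) = Nat.bit true (2 ^ i) := by
        simp [Nat.bit_val, pow_add]; ring
      rw [this, walsh_bit, walsh_two_pow]
      rfl
    convert! h using 1
    · ext i; rw [e]; ring
    · rw [walsh_zero, pow_zero, add_zero, walsh_one]; norm_num
  | succ K ih =>
    obtain ⟨a, n, rfl⟩ : ∃ b n', n = Nat.bit b n' := ⟨n.bodd, n.div2, (Nat.bit_bodd_div2 n).symm⟩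
    have hn' : n < 2 ^ K := by
      rw [Nat.bit_val, pow_succ] at hn
      omega
    have h := (ih (two_mul_notMem_dyadic ht) hn').mul_left (if a then rad t else 1)
    have e1 : 2 ^ (K + 1) + Nat.bit a n = Nat.bit a (2 ^ K + n) := by
      simp only [Nat.bit_val]; ring
    have e2 : ∀ i, Nat.bit a (2 ^ K + n) + 2 ^ (K + 1 + 1 + i) =
        Nat.bit a (2 ^ K + n + 2 ^ (K + 1 + i)) := fun i => by
      simp only [Nat.bit_val]; ring
    have e3 : ∀ f : ℝ → ℝ, opW a f t = (if a then rad t else 1) * f (2 * t) := fun f => by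
      cases a <;> simp [opW]
    simp only [e1, e2, walsh_bit]
    rw [volterra_opW a (walsh_periodic _) (BddMeas.walsh _) (integral_walsh (by positivity))]
    simp only [e3]
    convert! h using 1
    · ext i; ring
    · ring

theorem continuous_volterra {f : ℝ → ℝ} (hf : BddMeas f) : Continuous (volterra f) :=
  intervalIntegral.continuous_primitive hf.intervalIntegrable 0

theorem hasSum_walshCoeff {g : ℝ → ℝ} (hg : BddMeas g) (K : ℕ) {n : ℕ} (hn : n < 2 ^ K) :
    HasSum (fun i => (1 / 2 : ℝ) ^ (i + 1) * walshCoeff g (2 ^ K + n + 2 ^ (K + 1 + i)))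
      (walshCoeff g n -
        2 ^ (K + 2) * ∫ t in (0 : ℝ)..1, g t * volterra (walsh (2 ^ K + n)) t) := by
  obtain ⟨hm, C, hC⟩ := hg
  have hgs : Summable fun k : ℕ => (1 / 2 : ℝ) ^ (k + 1) :=
    (summable_nat_add_iff 1).mpr summable_geometric_two
  have hV := continuous_volterra (BddMeas.walsh (2 ^ K + n))
  have h := intervalIntegral.hasSum_integral_of_dominated_convergence (μ := volume)
    (a := 0) (b := 1) (ι := ℕ)
    (F := fun i t => (1 / 2 : ℝ) ^ (i + 1) * (g t * walsh (2 ^ K + n + 2 ^ (K + 1 + i)) t))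
    (f := fun t => g t * (walsh n t - 2 ^ (K + 2) * volterra (walsh (2 ^ K + n)) t))
    (fun i _ => (1 / 2 : ℝ) ^ (i + 1) * C)
    (fun i => ((hm.mul (measurable_walsh _)).const_mul _).aestronglyMeasurable)
    (fun i => Filter.Eventually.of_forall fun t _ => by
      rw [norm_mul, Real.norm_of_nonneg (by positivity), norm_mul]
      refine mul_le_mul_of_nonneg_left ?_ (by positivity)
      exact (mul_le_of_le_one_right (norm_nonneg _) (abs_walsh_le _ _)).trans (hC t))
    (Filter.Eventually.of_forall fun t _ => hgs.mul_right C)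
    (intervalIntegrable_const)
    (by
      filter_upwards [ae_notMem_dyadic] with t ht _
      convert! (hasSum_walsh ht K hn).mul_left (g t) using 1
      ext i
      ring)
  simp only [intervalIntegral.integral_const_mul] at h
  convert! h using 1
  have hg : BddMeas g := ⟨hm, C, hC⟩
  unfold walshCoeff
  rw [← intervalIntegral.integral_const_mul, ← intervalIntegral.integral_sub
    ((hg.mul (BddMeas.walsh n)).intervalIntegrable _ _)
    (((hg.intervalIntegrable _ _).mul_continuousOn hV.continuousOn).const_mul _)]
  refine intervalIntegral.integral_congr fun t _ => ?_
  ring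

/-! ### Integration by parts and the recursion for the coefficients of ρ_m. -/

theorem ae_deriv_volterra {f : ℝ → ℝ} (hf : BddMeas f) : ∀ᵐ t, deriv (volterra f) t = f t := by
  have hl : LocallyIntegrable f volume := by
    intro x
    refine ⟨Set.Ioc (x - 1) (x + 1), Ioc_mem_nhds (by linarith) (by linarith), ?_⟩
    exact (intervalIntegrable_iff_integrableOn_Ioc_of_le (by linarith)).mp
      (hf.intervalIntegrable _ _)
  filter_upwards [LocallyIntegrable.ae_hasDerivAt_integral hl] with t ht
  exact (ht 0).deriv

/-- The boundary terms vanish because V g is zero at 0 and at 1. The primitives are absolutely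
continuous, which suffices for integration by parts. -/
theorem integral_volterra_mul {f g : ℝ → ℝ} (hf : BddMeas f) (hg : BddMeas g)
    (hi : ∫ t in (0 : ℝ)..1, g t = 0) :
    ∫ t in (0 : ℝ)..1, volterra f t * g t = -∫ t in (0 : ℝ)..1, f t * volterra g t := by
  have hac : ∀ {f : ℝ → ℝ}, BddMeas f → AbsolutelyContinuousOnInterval (volterra f) 0 1 :=
    fun hf => (hf.intervalIntegrable 0 1).absolutelyContinuousOnInterval_intervalIntegral (by simp)
  have h := (hac hf).integral_mul_deriv_eq_deriv_mul (hac hg)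
  rw [volterra_zero, volterra_one_of_integral_eq_zero hi] at h
  have e1 : ∫ t in (0 : ℝ)..1, volterra f t * deriv (volterra g) t =
      ∫ t in (0 : ℝ)..1, volterra f t * g t := by
    refine intervalIntegral.integral_congr_ae ?_
    filter_upwards [ae_deriv_volterra hg] with t ht _
    rw [ht]
  have e2 : ∫ t in (0 : ℝ)..1, deriv (volterra f) t * volterra g t =
      ∫ t in (0 : ℝ)..1, f t * volterra g t := by
    refine intervalIntegral.integral_congr_ae ?_
    filter_upwards [ae_deriv_volterra hf] with t ht _
    rw [ht]
  rw [e1, e2] at h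
  rw [h]
  ring

theorem walshCoeff_rho_succ (m : ℕ) {n : ℕ} (hn : n ≠ 0) :
    walshCoeff (rho (m + 1)) n =
      -4 * ∫ t in (0 : ℝ)..1, opW true (rho m) t * volterra (walsh n) t := by
  have h := integral_volterra_mul ((BddMeas.rho m).opW true) (BddMeas.walsh n) (integral_walsh hn)
  unfold walshCoeff
  simp only [rho_succ, mul_assoc]
  rw [intervalIntegral.integral_const_mul, h]
  ring

/-- W_1 ρ_m has no coefficients at even indices. Applied to it at an even index, `hasSum_walshCoeff`
involves only such coefficients, so the remaining integral must be zero. -/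
theorem walshCoeff_rho_even (m : ℕ) {n : ℕ} (hn : n ≠ 0) :
    walshCoeff (rho (m + 1)) (2 * n) = 0 := by
  obtain ⟨k, n', hn', rfl⟩ : ∃ k n', n' < 2 ^ k ∧ n = 2 ^ k + n' :=
    ⟨Nat.log 2 n, n - 2 ^ Nat.log 2 n, by
      have := Nat.lt_pow_succ_log_self one_lt_two n
      have := Nat.pow_log_le_self 2 hn
      rw [pow_succ] at *
      omega, by have := Nat.pow_log_le_self 2 hn; omega⟩
  have h := hasSum_walshCoeff ((BddMeas.rho m).opW true) (k + 1) (n := Nat.bit false n')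
    (by rw [Nat.bit_val, pow_succ]; simp; omega)
  have e1 : 2 ^ (k + 1) + Nat.bit false n' = Nat.bit false (2 ^ k + n') := by
    simp only [Nat.bit_val]; ring
  have e2 : ∀ i, Nat.bit false (2 ^ k + n') + 2 ^ (k + 1 + 1 + i) =
      Nat.bit false (2 ^ k + n' + 2 ^ (k + 1 + i)) := fun i => by
    simp only [Nat.bit_val]; ring
  simp only [e1, e2, walshCoeff_opW true false (rho_periodic m) (BddMeas.rho m)] at h
  simp only [Bool.true_eq_false, if_false, mul_zero] at h
  have h0 := h.unique hasSum_zero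
  have e3 : 2 * (2 ^ k + n') = Nat.bit false (2 ^ k + n') := by simp [Nat.bit_val]
  rw [e3, walshCoeff_rho_succ m (by simp [Nat.bit_val])]
  have : (2 : ℝ) ^ (k + 1 + 2) ≠ 0 := by positivity
  have h4 := (mul_eq_zero.mp (by linarith : (2 : ℝ) ^ (k + 1 + 2) *
    ∫ t in (0 : ℝ)..1, opW true (rho m) t *
      volterra (walsh (Nat.bit false (2 ^ k + n'))) t = 0)).resolve_left this
  rw [h4, mul_zero]

/-- At odd indices W_1 merely strips the lowest digit 1, so `hasSum_walshCoeff` for W_1 ρ_m relates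
c_{m+1} to c_m. The scaling by 2^{-(k+1)} turns 2^{k+3} into the 4 of 4 V W_1. -/
theorem hasSum_walshCoeff_rho (m k : ℕ) {n : ℕ} (hn : n < 2 ^ k) :
    HasSum (fun i => (1 / 2 : ℝ) ^ (k + i + 2) * walshCoeff (rho m) (2 ^ k + n + 2 ^ (k + 1 + i)))
      (walshCoeff (rho (m + 1)) (1 + 2 * (2 ^ k + n)) +
        (1 / 2) ^ (k + 1) * walshCoeff (rho m) n) := by
  have h := hasSum_walshCoeff ((BddMeas.rho m).opW true) (k + 1) (n := Nat.bit true n)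
    (by rw [Nat.bit_val, pow_succ]; simp; omega)
  have e1 : 2 ^ (k + 1) + Nat.bit true n = Nat.bit true (2 ^ k + n) := by
    simp only [Nat.bit_val]; ring
  have e2 : ∀ i, Nat.bit true (2 ^ k + n) + 2 ^ (k + 1 + 1 + i) =
      Nat.bit true (2 ^ k + n + 2 ^ (k + 1 + i)) := fun i => by
    simp only [Nat.bit_val]; ring
  simp only [e1, e2, walshCoeff_opW true true (rho_periodic m) (BddMeas.rho m), if_true] at h
  have e3 : 1 + 2 * (2 ^ k + n) = Nat.bit true (2 ^ k + n) := by simp [Nat.bit_val]; ring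
  rw [e3, walshCoeff_rho_succ m (by simp [Nat.bit_val])]
  convert! h.mul_left ((1 / 2 : ℝ) ^ (k + 1)) using 1
  · ext i; ring
  · have : (1 / 2 : ℝ) ^ (k + 1) * 2 ^ (k + 1 + 2) = 4 := by
      rw [pow_add 2 (k + 1) 2, ← mul_assoc, ← mul_pow]; norm_num
    linear_combination (∫ t in (0 : ℝ)..1, opW true (rho m) t *
      volterra (walsh (Nat.bit true (2 ^ k + n))) t) * this

/-! ### Recursion for sequences of Walsh coefficients -/

/-- The recursion that leads from the Walsh coefficients of `ρ_m` to those of `ρ_{m+1}`. -/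
structure WalshStep (c c' : ℕ → ℝ) : Prop where
  zero : c' 0 = 1
  one : c' 1 = 0
  seven : c' 7 = 0
  even : ∀ n, n ≠ 0 → c' (2 * n) = 0
  hasSum : ∀ k n, n < 2 ^ k →
    HasSum (fun i => (1 / 2 : ℝ) ^ (k + i + 2) * c (2 ^ k + n + 2 ^ (k + 1 + i)))
      (c' (1 + 2 * (2 ^ k + n)) + (1 / 2) ^ (k + 1) * c n)

theorem walshStep_rho (m : ℕ) : WalshStep (walshCoeff (rho m)) (walshCoeff (rho (m + 1))) where
  zero := walshCoeff_rho_zero _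
  one := walshCoeff_rho_one _
  seven := walshCoeff_rho_seven _
  even _ hn := walshCoeff_rho_even m hn
  hasSum k _ hn := hasSum_walshCoeff_rho m k hn

/-- Bounds for Walsh coefficients that are preserved by the recursion. -/
structure Admissible (c : ℕ → ℝ) : Prop where
  zero : c 0 = 1
  one : c 1 = 0
  even : ∀ n, n ≠ 0 → c (2 * n) = 0
  three : |c 3| ≤ 13 / 18
  pow : ∀ l, |c (1 + 2 ^ (l + 2))| ≤ (1 / 2) ^ (l + 2)
  level : ∀ l, ∑ n ∈ Finset.Ico (2 ^ l) (2 ^ (l + 1)), c n ^ 2 ≤ 4 * (1 / 4) ^ l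

theorem sum_geom_le (J : ℕ) : ∑ i ∈ Finset.range J, (1 / 4 : ℝ) ^ i ≤ 4 / 3 := by
  have h := geom_sum_eq (x := (1 / 4 : ℝ)) (by norm_num) J
  rw [h]
  have : (0 : ℝ) ≤ (1 / 4) ^ J := by positivity
  norm_num
  linarith

theorem sum_range_two_mul (f : ℕ → ℝ) (N : ℕ) :
    ∑ p ∈ Finset.range (2 * N), f p = ∑ n ∈ Finset.range N, (f (2 * n) + f (1 + 2 * n)) := by
  induction N with
  | zero => simp
  | succ N ih =>
    rw [show 2 * (N + 1) = 2 * N + 1 + 1 by ring, Finset.sum_range_succ, Finset.sum_range_succ,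
      Finset.sum_range_succ, ih, add_comm (2 * N) 1]
    ring

theorem sum_level (f : ℕ → ℝ) (l : ℕ) : ∑ p ∈ Finset.Ico (2 ^ l) (2 ^ (l + 1)), f p =
    ∑ n ∈ Finset.range (2 ^ l), f (2 ^ l + n) := by
  rw [Finset.sum_Ico_eq_sum_range]
  congr 2
  rw [pow_succ]
  omega

theorem sum_level_succ (f : ℕ → ℝ) (k : ℕ) :
    ∑ p ∈ Finset.Ico (2 ^ (k + 1)) (2 ^ (k + 2)), f p =
      ∑ n ∈ Finset.range (2 ^ k), (f (2 * (2 ^ k + n)) + f (1 + 2 * (2 ^ k + n))) := by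
  rw [sum_level, pow_succ, mul_comm, sum_range_two_mul fun n => f (2 * 2 ^ k + n)]
  refine Finset.sum_congr rfl fun n _ => ?_
  congr 2 <;> ring

namespace Admissible

variable {c c' : ℕ → ℝ}

/-- The constant is 7/3 = 1 + ∑_{l ≥ 1} 4 · 4^{-l}; level 0 contributes nothing because c 1 = 0. -/
theorem sum_sq_le (hc : Admissible c) (k : ℕ) :
    ∑ n ∈ Finset.range (2 ^ (k + 1)), c n ^ 2 ≤ 7 / 3 - 4 / 3 * (1 / 4) ^ k := by
  induction k with
  | zero => norm_num [Finset.sum_range_succ, hc.zero, hc.one]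
  | succ k ih =>
    rw [← Finset.sum_range_add_sum_Ico _
      (Nat.pow_le_pow_right two_pos (Nat.le_succ (k + 1)) : 2 ^ (k + 1) ≤ 2 ^ (k + 1 + 1))]
    have h := hc.level (k + 1)
    rw [pow_succ (1 / 4 : ℝ)] at h ⊢
    linarith

theorem sum_sq_le' (hc : Admissible c) (k : ℕ) :
    ∑ n ∈ Finset.range (2 ^ k), c n ^ 2 ≤ 7 / 3 := by
  cases k with
  | zero => norm_num [hc.zero]
  | succ k =>
    have h := hc.sum_sq_le k
    have : (0 : ℝ) ≤ (1 / 4) ^ k := by positivity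
    linarith

/-- Cauchy–Schwarz in i for the partial sums: the squared weights sum to at most 4^{-k}/12. The
index 2^k + n + 2^{k+1+i} lies on level k+1+i, so the level bounds sum to at most (4/3) 4^{-k}. -/
theorem sum_tail_sq_le (hc : Admissible c) (h : WalshStep c c') (k : ℕ) :
    ∑ n ∈ Finset.range (2 ^ k), (c' (1 + 2 * (2 ^ k + n)) + (1 / 2) ^ (k + 1) * c n) ^ 2 ≤
      (1 / 16) ^ k / 9 := by
  have ht : Filter.Tendsto (fun J => ∑ n ∈ Finset.range (2 ^ k),
      (∑ i ∈ Finset.range J, (1 / 2 : ℝ) ^ (k + i + 2) * c (2 ^ k + n + 2 ^ (k + 1 + i))) ^ 2)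
      Filter.atTop (nhds (∑ n ∈ Finset.range (2 ^ k),
        (c' (1 + 2 * (2 ^ k + n)) + (1 / 2) ^ (k + 1) * c n) ^ 2)) :=
    tendsto_finsetSum _ fun n hn =>
      ((h.hasSum k n (Finset.mem_range.mp hn)).tendsto_sum_nat).pow 2
  refine le_of_tendsto' ht fun J => ?_
  have h1 : ∑ i ∈ Finset.range J, ((1 / 2 : ℝ) ^ (k + i + 2)) ^ 2 ≤ (1 / 4) ^ k / 12 := by
    have e : ∀ i, ((1 / 2 : ℝ) ^ (k + i + 2)) ^ 2 = (1 / 4) ^ k / 16 * (1 / 4) ^ i := fun i => by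
      rw [← pow_mul, mul_comm, pow_mul, pow_add, pow_add]
      norm_num
      ring
    simp only [e]
    rw [← Finset.mul_sum]
    have : (0 : ℝ) ≤ (1 / 4) ^ k := by positivity
    nlinarith [sum_geom_le J]
  have h2 : ∑ n ∈ Finset.range (2 ^ k), ∑ i ∈ Finset.range J,
      c (2 ^ k + n + 2 ^ (k + 1 + i)) ^ 2 ≤ 4 / 3 * (1 / 4) ^ k := by
    rw [Finset.sum_comm]
    have h3 : ∀ i, ∑ n ∈ Finset.range (2 ^ k), c (2 ^ k + n + 2 ^ (k + 1 + i)) ^ 2 ≤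
        (1 / 4) ^ k * (1 / 4) ^ i := fun i => by
      refine le_trans ?_ ((hc.level (k + 1 + i)).trans (le_of_eq (by ring)))
      rw [sum_level]
      have : ∑ n ∈ Finset.range (2 ^ k), c (2 ^ k + n + 2 ^ (k + 1 + i)) ^ 2 =
          ∑ n ∈ Finset.Ico (2 ^ k) (2 ^ (k + 1)), c (2 ^ (k + 1 + i) + n) ^ 2 := by
        rw [sum_level]
        refine Finset.sum_congr rfl fun n _ => ?_
        rw [add_comm]
      rw [this]
      refine Finset.sum_le_sum_of_subset_of_nonneg (fun n hn => ?_) fun _ _ _ => sq_nonneg _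
      rw [Finset.mem_Ico] at hn
      exact Finset.mem_range.mpr (hn.2.trans_le
        (Nat.pow_le_pow_right two_pos (Nat.le_add_right _ _)))
    refine (Finset.sum_le_sum fun i _ => h3 i).trans ?_
    rw [← Finset.mul_sum]
    have : (0 : ℝ) ≤ (1 / 4) ^ k := by positivity
    nlinarith [sum_geom_le J]
  calc _ ≤ ∑ n ∈ Finset.range (2 ^ k), (1 / 4) ^ k / 12 * ∑ i ∈ Finset.range J,
        c (2 ^ k + n + 2 ^ (k + 1 + i)) ^ 2 := by
        refine Finset.sum_le_sum fun n _ => ?_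
        refine (Finset.sum_mul_sq_le_sq_mul_sq _ _ _).trans ?_
        exact mul_le_mul_of_nonneg_right h1 (Finset.sum_nonneg fun _ _ => sq_nonneg _)
    _ ≤ (1 / 4) ^ k / 12 * (4 / 3 * (1 / 4) ^ k) := by
        rw [← Finset.mul_sum]
        exact mul_le_mul_of_nonneg_left h2 (by positivity)
    _ = (1 / 16) ^ k / 9 := by
        rw [show (1 / 16 : ℝ) = 1 / 4 * (1 / 4) by norm_num, mul_pow]
        ring

/-- For n = 0 and a positive level the series of the recursion runs over even indices only, so the
leading term is exact. -/
theorem step_pow (hc : Admissible c) (h : WalshStep c c') (k : ℕ) :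
    c' (1 + 2 ^ (k + 2)) = -(1 / 2) ^ (k + 2) := by
  have h1 := h.hasSum (k + 1) 0 (by positivity)
  have e : ∀ i, c (2 ^ (k + 1) + 0 + 2 ^ (k + 1 + 1 + i)) = 0 := fun i => by
    rw [show 2 ^ (k + 1) + 0 + 2 ^ (k + 1 + 1 + i) = 2 * (2 ^ k + 2 ^ (k + 1 + i)) by ring]
    exact hc.even _ (by positivity)
  simp only [e, mul_zero, hc.zero] at h1
  have h2 := h1.unique hasSum_zero
  rw [show 1 + 2 ^ (k + 2) = 1 + 2 * (2 ^ (k + 1) + 0) by ring]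
  linarith

/-- The bound is a fixed point of the recursion: 13/18 = 1/2 + (1/4)(13/18) + 1/24. -/
theorem step_three (hc : Admissible c) (h : WalshStep c c') : |c' 3| ≤ 13 / 18 := by
  have h1 := h.hasSum 0 0 (by norm_num)
  -- The majorant is (1/8) 4^{-i} for i ≥ 1, from `pow`; its term i = 0 is corrected to (1/4)(13/18)
  -- = 13/72, from `three`.
  have h2 : HasSum (fun i : ℕ => 1 / 8 * (1 / 4 : ℝ) ^ i + if i = 0 then 13 / 72 - 1 / 8 else 0)
      (1 / 8 * (1 - 1 / 4)⁻¹ + (13 / 72 - 1 / 8)) :=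
    ((hasSum_geometric_of_lt_one (by norm_num) (by norm_num)).mul_left _).add
      (hasSum_ite_eq 0 _)
  have h3 := h1.norm_le_of_bounded h2 fun i => by
    rcases i with _ | i
    · have := hc.three
      norm_num [abs_mul]
      linarith
    · have := hc.pow i
      rw [norm_mul, Real.norm_of_nonneg (by positivity), Real.norm_eq_abs,
        show 2 ^ 0 + 0 + 2 ^ (0 + 1 + (i + 1)) = 1 + 2 ^ (i + 2) by ring]
      refine (mul_le_mul_of_nonneg_left this (by positivity)).trans (le_of_eq ?_)
      rw [show (1 / 4 : ℝ) = 1 / 2 * (1 / 2) by norm_num, mul_pow]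
      simp
      ring
  norm_num [hc.zero] at h3
  rw [abs_le] at h3 ⊢
  constructor <;> linarith

theorem step (hc : Admissible c) (h : WalshStep c c') : Admissible c' where
  zero := h.zero
  one := h.one
  even := h.even
  three := hc.step_three h
  pow l := by
    rw [hc.step_pow h, abs_neg, abs_of_nonneg (by positivity)]
  level l := by
    rcases l with _ | k
    · norm_num [h.one]
    rw [sum_level_succ fun n => c' n ^ 2]
    have ht := hc.sum_tail_sq_le h k
    -- Weighted inequality (t - a)² ≤ 5 t² + (5/4) a², where t is the series of the recursion and a
    -- = 2^{-(k+1)} c n.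
    have hs : ∑ n ∈ Finset.range (2 ^ k), (c' (2 * (2 ^ k + n)) ^ 2 +
        c' (1 + 2 * (2 ^ k + n)) ^ 2) ≤
        5 / 4 * (1 / 4) ^ (k + 1) * ∑ n ∈ Finset.range (2 ^ k), c n ^ 2 +
        5 * ∑ n ∈ Finset.range (2 ^ k),
          (c' (1 + 2 * (2 ^ k + n)) + (1 / 2) ^ (k + 1) * c n) ^ 2 := by
      rw [Finset.mul_sum, Finset.mul_sum, ← Finset.sum_add_distrib]
      refine Finset.sum_le_sum fun n _ => ?_
      rw [h.even _ (by positivity), show (1 / 4 : ℝ) = 1 / 2 * (1 / 2) by norm_num, mul_pow]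
      nlinarith [sq_nonneg ((c' (1 + 2 * (2 ^ k + n)) + (1 / 2) ^ (k + 1) * c n) * 4 -
        (1 / 2) ^ (k + 1) * c n + 2 * (1 / 2) ^ (k + 1) * c n)]
    refine hs.trans ?_
    -- For k = 0 only c 0 = 1 enters and 5/16 + 5/9 < 1, whereas 7/3 would be too large. For k ≥ 1
    -- the claim reduces to (5/4)(7/3) + 5/9 < 4.
    rcases k with _ | k
    · norm_num [hc.zero] at ht ⊢
      linarith
    · have h1 := hc.sum_sq_le' (k + 1)
      have h2 : (1 / 16 : ℝ) ^ (k + 1) ≤ (1 / 4) ^ (k + 1 + 1) := by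
        rw [show (1 / 16 : ℝ) = 1 / 4 * (1 / 4) by norm_num, mul_pow, pow_succ (1 / 4 : ℝ) (k + 1)]
        refine mul_le_mul_of_nonneg_left ?_ (by positivity)
        exact pow_le_of_le_one (by norm_num) (by norm_num) (by simp)
      have h3 : (0 : ℝ) ≤ (1 / 4) ^ (k + 1 + 1) := by positivity
      nlinarith

end Admissible

theorem admissible_rho (m : ℕ) : Admissible (walshCoeff (rho m)) := by
  induction m with
  | zero =>
    have h : walshCoeff (rho 0) = fun n => if n = 0 then 1 else 0 := by
      ext n
      exact walshCoeff_one n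
    rw [h]
    refine ⟨by simp, by simp, fun n hn => by simp [hn], by norm_num, fun l => by simp, fun l => ?_⟩
    rw [Finset.sum_eq_zero]
    · positivity
    · intro n hn
      have : 0 < 2 ^ l := by positivity
      rw [Finset.mem_Ico] at hn
      rw [if_neg (by omega)]
      norm_num
  | succ m ih => exact ih.step (walshStep_rho m)

/-! ### Binary concatenation of indices -/

theorem log_two_pow_add {K q : ℕ} (hq : q < 2 ^ K) : Nat.log 2 (2 ^ K + q) = K := by
  rw [Nat.log_eq_iff (Or.inr ⟨one_lt_two, by positivity⟩), pow_succ]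
  omega

theorem log_add_mul {n s p : ℕ} (hn : n < 2 ^ s) (hp : p ≠ 0) :
    Nat.log 2 (n + 2 ^ s * p) = s + Nat.log 2 p := by
  have h1 := Nat.pow_log_le_self 2 hp
  have h2 := Nat.lt_pow_succ_log_self one_lt_two p
  have h3 : 0 < 2 ^ s := by positivity
  rw [Nat.log_eq_iff (Or.inr ⟨one_lt_two, by positivity⟩)]
  constructor
  · rw [pow_add]
    exact (Nat.mul_le_mul_left _ h1).trans (Nat.le_add_left _ _)
  · rw [add_assoc, pow_add]
    calc n + 2 ^ s * p < 2 ^ s * (p + 1) := by rw [mul_add]; omega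
      _ ≤ _ := Nat.mul_le_mul_left _ h2

theorem add_mul_inj {n n' s p p' : ℕ} (hn : n < 2 ^ s) (hn' : n' < 2 ^ s)
    (h : n + 2 ^ s * p = n' + 2 ^ s * p') : n = n' ∧ p = p' := by
  have h1 := congrArg (· % 2 ^ s) h
  have h2 := congrArg (· / 2 ^ s) h
  simp only [Nat.add_mul_mod_self_left, Nat.mod_eq_of_lt hn, Nat.mod_eq_of_lt hn'] at h1
  simp only [Nat.add_mul_div_left _ _ (show 0 < 2 ^ s by positivity), Nat.div_eq_of_lt hn,
    Nat.div_eq_of_lt hn', zero_add] at h2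
  exact ⟨h1, h2⟩

theorem lt_two_pow_size (n : ℕ) : n < 2 ^ n.size := Nat.lt_size_self n

/-- The index whose binary digits are those of `n` followed by those of `p`. -/
def append (n p : ℕ) : ℕ := n + 2 ^ n.size * p

theorem append_right_injective (n : ℕ) : Function.Injective (append n) := fun _ _ h =>
  (add_mul_inj (lt_two_pow_size n) (lt_two_pow_size n) h).2

/-- The top digit of the concatenation sits at `n.size + log p`; knowing `log p` therefore reveals
where n ends. -/
theorem append_inj_of_log_eq {n n' p p' : ℕ} (hp : p ≠ 0) (hp' : p' ≠ 0)
    (hl : Nat.log 2 p = Nat.log 2 p') (h : append n p = append n' p') : n = n' ∧ p = p' := by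
  unfold append at h
  have h1 := congrArg (Nat.log 2) h
  rw [log_add_mul (lt_two_pow_size n) hp, log_add_mul (lt_two_pow_size n') hp', hl] at h1
  have hs : n.size = n'.size := by omega
  have hn := lt_two_pow_size n
  rw [hs] at h hn
  exact add_mul_inj hn (lt_two_pow_size n') h

/-- Here the length of p may vary. Deleting the common top digit leaves a number whose top digit is
at `n.size + l`, and this again reveals where n ends. -/
theorem append_inj_of_second_log_eq {n n' K K' q q' l : ℕ} (hq : q ∈ Finset.Ico (2 ^ l) (2 ^ (l + 1)))
    (hq' : q' ∈ Finset.Ico (2 ^ l) (2 ^ (l + 1))) (hK : l < K) (hK' : l < K')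
    (h : append n (2 ^ K + q) = append n' (2 ^ K' + q')) : n = n' ∧ 2 ^ K + q = 2 ^ K' + q' := by
  rw [Finset.mem_Ico] at hq hq'
  have hqK : q < 2 ^ K := hq.2.trans_le (Nat.pow_le_pow_right two_pos hK)
  have hqK' : q' < 2 ^ K' := hq'.2.trans_le (Nat.pow_le_pow_right two_pos hK')
  have h0 : 0 < 2 ^ l := by positivity
  have hlog : ∀ {q : ℕ}, 2 ^ l ≤ q → q < 2 ^ (l + 1) → Nat.log 2 q = l := fun h1 h2 =>
    Nat.log_eq_of_pow_le_of_lt_pow h1 h2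
  unfold append at h
  have h1 := congrArg (Nat.log 2) h
  rw [log_add_mul (lt_two_pow_size n) (by positivity),
    log_add_mul (lt_two_pow_size n') (by positivity), log_two_pow_add hqK,
    log_two_pow_add hqK'] at h1
  have h2 : n + 2 ^ n.size * q = n' + 2 ^ n'.size * q' := by
    have : 2 ^ n.size * 2 ^ K = 2 ^ n'.size * 2 ^ K' := by rw [← pow_add, ← pow_add, h1]
    rw [mul_add, mul_add, this] at h
    omega
  have h3 := congrArg (Nat.log 2) h2
  rw [log_add_mul (lt_two_pow_size n) (by omega), log_add_mul (lt_two_pow_size n') (by omega),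
    hlog hq.1 hq.2, hlog hq'.1 hq'.2] at h3
  have hs : n.size = n'.size := by omega
  have hn := lt_two_pow_size n
  rw [hs] at h hn
  exact add_mul_inj hn (lt_two_pow_size n') h

/-! ### Norm bounds for sums of shifts -/

section Shift

variable {𝕜 : Type*} [RCLike 𝕜] {H : Type*} [NormedAddCommGroup H] [InnerProductSpace 𝕜 H]

/-- The operator `e_n ↦ ∑_{1 ≤ p < 2^L} d_p e_{append n p}`, `n ≥ 1`, is bounded by `q`. -/
def ShiftBound (𝕜 : Type*) [RCLike 𝕜] {H : Type*} [NormedAddCommGroup H] [InnerProductSpace 𝕜 H]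
    (e : ℕ → H) (L : ℕ) (d : ℕ → ℝ) (q : ℝ) : Prop :=
  ∀ (F : Finset ℕ) (x : ℕ → 𝕜), 0 ∉ F →
    ‖∑ n ∈ F, x n • ∑ p ∈ Finset.Ico 1 (2 ^ L), (d p : 𝕜) • e (append n p)‖ ≤
      q * √(∑ n ∈ F, ‖x n‖ ^ 2)

theorem ShiftBound.add {e : ℕ → H} {L : ℕ} {d d' : ℕ → ℝ} {q q' : ℝ} (h : ShiftBound 𝕜 e L d q)
    (h' : ShiftBound 𝕜 e L d' q') : ShiftBound 𝕜 e L (fun p => d p + d' p) (q + q') := by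
  intro F x hF
  have : ∑ n ∈ F, x n • ∑ p ∈ Finset.Ico 1 (2 ^ L), ((d p + d' p : ℝ) : 𝕜) • e (append n p) =
      (∑ n ∈ F, x n • ∑ p ∈ Finset.Ico 1 (2 ^ L), (d p : 𝕜) • e (append n p)) +
      ∑ n ∈ F, x n • ∑ p ∈ Finset.Ico 1 (2 ^ L), (d' p : 𝕜) • e (append n p) := by
    simp only [RCLike.ofReal_add, add_smul, Finset.sum_add_distrib, smul_add]
  rw [this, add_mul]
  exact (norm_add_le _ _).trans (add_le_add (h F x hF) (h' F x hF))

theorem ShiftBound.zero (e : ℕ → H) (L : ℕ) : ShiftBound 𝕜 e L (fun _ => 0) 0 := by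
  intro F x _
  simp

theorem ShiftBound.sum {e : ℕ → H} {L : ℕ} {ι : Type*} (s : Finset ι) {d : ι → ℕ → ℝ} {q : ι → ℝ}
    (h : ∀ i ∈ s, ShiftBound 𝕜 e L (d i) (q i)) :
    ShiftBound 𝕜 e L (fun p => ∑ i ∈ s, d i p) (∑ i ∈ s, q i) := by
  classical
  induction s using Finset.induction_on with
  | empty => simpa using ShiftBound.zero e L
  | insert i s hi ih =>
    simp only [Finset.sum_insert hi]
    exact (h i (Finset.mem_insert_self _ _)).add
      (ih fun j hj => h j (Finset.mem_insert_of_mem hj))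

theorem ShiftBound.congr {e : ℕ → H} {L : ℕ} {d d' : ℕ → ℝ} {q q' : ℝ} (h : ShiftBound 𝕜 e L d q)
    (hd : ∀ p ∈ Finset.Ico 1 (2 ^ L), d' p = d p) (hq : q ≤ q') : ShiftBound 𝕜 e L d' q' := by
  intro F x hF
  refine le_trans (le_of_eq ?_) ((h F x hF).trans (mul_le_mul_of_nonneg_right hq (Real.sqrt_nonneg _)))
  congr 1
  refine Finset.sum_congr rfl fun n _ => ?_
  congr 1
  exact Finset.sum_congr rfl fun p hp => by rw [hd p hp]

theorem norm_sq_sum_of_orthonormal {e : ℕ → H} (he : Orthonormal 𝕜 e) {ι : Type*} (s : Finset ι)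
    (φ : ι → ℕ) (hφ : Set.InjOn φ s) (a : ι → 𝕜) :
    ‖∑ i ∈ s, a i • e (φ i)‖ ^ 2 = ∑ i ∈ s, ‖a i‖ ^ 2 := by
  have ho : Orthonormal 𝕜 fun i : s => e (φ i) :=
    he.comp (fun i : s => φ i) fun i j hij => Subtype.ext (hφ i.2 j.2 hij)
  have h := ho.inner_sum (fun i : s => a i) (fun i : s => a i) Finset.univ
  have e1 : ∑ i : s, a i • e (φ i) = ∑ i ∈ s, a i • e (φ i) :=
    Finset.sum_coe_sort s fun i => a i • e (φ i)
  rw [e1, inner_self_eq_norm_sq_to_K] at h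
  have h2 : ∀ i : s, (starRingEnd 𝕜) (a i) * a i = ((‖a i‖ ^ 2 : ℝ) : 𝕜) := fun i => by
    rw [RCLike.conj_mul]
    norm_cast
  simp only [h2] at h
  rw [Finset.sum_coe_sort s fun i => ((‖a i‖ ^ 2 : ℝ) : 𝕜)] at h
  exact_mod_cast h

/-- All vectors e (append n p) that occur are distinct, so by Pythagoras the operator norm is at
most the ℓ² norm of d on P. -/
theorem ShiftBound.of_injOn {e : ℕ → H} (he : Orthonormal 𝕜 e) {L : ℕ} {d : ℕ → ℝ} {q : ℝ}
    (hq : 0 ≤ q) (P : Finset ℕ) (hd : ∀ p ∈ Finset.Ico 1 (2 ^ L), p ∉ P → d p = 0)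
    (hinj : ∀ n n', ∀ p ∈ P, ∀ p' ∈ P, append n p = append n' p' → n = n' ∧ p = p')
    (hP : ∑ p ∈ P, d p ^ 2 ≤ q ^ 2) : ShiftBound 𝕜 e L d q := by
  intro F x _
  have h1 : ∀ n, ∑ p ∈ Finset.Ico 1 (2 ^ L), (d p : 𝕜) • e (append n p) =
      ∑ p ∈ Finset.Ico 1 (2 ^ L) ∩ P, (d p : 𝕜) • e (append n p) := fun n => by
    refine (Finset.sum_subset Finset.inter_subset_left fun p hp hp' => ?_).symm
    rw [hd p hp fun h => hp' (Finset.mem_inter.mpr ⟨hp, h⟩)]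
    simp
  have h2 : ∑ n ∈ F, x n • ∑ p ∈ Finset.Ico 1 (2 ^ L), (d p : 𝕜) • e (append n p) =
      ∑ i ∈ F ×ˢ (Finset.Ico 1 (2 ^ L) ∩ P), (x i.1 * d i.2) • e (append i.1 i.2) := by
    rw [Finset.sum_product]
    refine Finset.sum_congr rfl fun n _ => ?_
    rw [h1, Finset.smul_sum]
    simp only [mul_smul]
  have h3 := norm_sq_sum_of_orthonormal he (F ×ˢ (Finset.Ico 1 (2 ^ L) ∩ P))
    (fun i => append i.1 i.2) (fun i hi j hj hij => by
      simp only [Finset.coe_product, Set.mem_prod, Finset.mem_coe, Finset.mem_inter] at hi hj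
      have := hinj i.1 j.1 i.2 hi.2.2 j.2 hj.2.2 hij
      exact Prod.ext this.1 this.2) (fun i => x i.1 * (d i.2 : 𝕜))
  rw [h2]
  refine (sq_le_sq₀ (norm_nonneg _) (by positivity)).mp ?_
  rw [h3, mul_pow, Real.sq_sqrt (Finset.sum_nonneg fun _ _ => sq_nonneg _), Finset.sum_product]
  have h4 : ∀ n, ∑ p ∈ Finset.Ico 1 (2 ^ L) ∩ P, ‖x n * (d p : 𝕜)‖ ^ 2 ≤ q ^ 2 * ‖x n‖ ^ 2 := by
    intro n
    have : ∀ p, ‖x n * (d p : 𝕜)‖ ^ 2 = ‖x n‖ ^ 2 * d p ^ 2 := fun p => by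
      rw [norm_mul, mul_pow, RCLike.norm_ofReal, sq_abs]
    simp only [this]
    rw [← Finset.mul_sum, mul_comm]
    refine mul_le_mul_of_nonneg_right (le_trans ?_ hP) (sq_nonneg _)
    exact Finset.sum_le_sum_of_subset_of_nonneg Finset.inter_subset_right fun _ _ _ => sq_nonneg _
  refine (Finset.sum_le_sum fun n _ => h4 n).trans (le_of_eq ?_)
  rw [Finset.mul_sum]

end Shift

/-! ### The decomposition of the coefficient sequence -/

/-- The part of the coefficients `c'` that comes from appending one digit `1` to the indices of the
coefficients `c`. -/
noncomputable def mainPart (c c' : ℕ → ℝ) (p : ℕ) : ℝ :=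
  if p = 3 then c' 3
  else if (p - 2 ^ Nat.log 2 p) % 2 = 1 then
    -(1 / 2) ^ Nat.log 2 p * c ((p - 2 ^ Nat.log 2 p) / 2)
  else 0

theorem mainPart_eq {c c' : ℕ → ℝ} {K q : ℕ} (hq : q < 2 ^ K) (h3 : 2 ^ K + q ≠ 3) :
    mainPart c c' (2 ^ K + q) = if q % 2 = 1 then -(1 / 2) ^ K * c (q / 2) else 0 := by
  unfold mainPart
  rw [if_neg h3, log_two_pow_add hq, Nat.add_sub_cancel_left]

namespace Admissible

variable {c c' : ℕ → ℝ}

theorem mainPart_even (c c' : ℕ → ℝ) {k n : ℕ} (hn : n < 2 ^ k) :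
    mainPart c c' (2 * (2 ^ k + n)) = 0 := by
  have e : 2 * (2 ^ k + n) = 2 ^ (k + 1) + 2 * n := by ring
  rw [e, mainPart_eq (by rw [pow_succ]; omega) (by omega), if_neg (by omega)]

theorem mainPart_odd (c c' : ℕ → ℝ) {k n : ℕ} (hn : n < 2 ^ k) (hk : 1 + 2 * (2 ^ k + n) ≠ 3) :
    mainPart c c' (1 + 2 * (2 ^ k + n)) = -(1 / 2) ^ (k + 1) * c n := by
  have e : 1 + 2 * (2 ^ k + n) = 2 ^ (k + 1) + (1 + 2 * n) := by ring
  rw [e] at hk ⊢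
  rw [mainPart_eq (by rw [pow_succ]; omega) hk, if_pos (by omega)]
  congr 2
  omega

theorem sum_sub_mainPart_sq_le (hc : Admissible c) (h : WalshStep c c') {k : ℕ} (hk : k ≠ 0) :
    ∑ p ∈ Finset.Ico (2 ^ (k + 1)) (2 ^ (k + 2)), (c' p - mainPart c c' p) ^ 2 ≤
      ((1 / 4) ^ k / 3) ^ 2 := by
  rw [sum_level_succ fun p => (c' p - mainPart c c' p) ^ 2]
  have h1 : 2 ≤ 2 ^ k := by
    calc 2 = 2 ^ 1 := rfl
      _ ≤ 2 ^ k := Nat.pow_le_pow_right two_pos (by omega)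
  refine le_trans (le_of_eq ?_) ((hc.sum_tail_sq_le h k).trans (le_of_eq ?_))
  · refine Finset.sum_congr rfl fun n hn => ?_
    rw [Finset.mem_range] at hn
    rw [h.even _ (by positivity), mainPart_even c c' hn, mainPart_odd c c' hn (by omega)]
    ring
  · rw [show (1 / 16 : ℝ) = 1 / 4 * (1 / 4) by norm_num, mul_pow]
    ring

/-- There is no remainder for p < 8: 3 is taken over whole, 5 is exact by `step_pow`, and at 7 both
sides vanish since c 1 = 0. Without these levels the remainder is small enough for `sum_bounds_le`.
-/
theorem eq_mainPart (hc : Admissible c) (h : WalshStep c c') {p : ℕ} (h0 : 1 ≤ p) (hp : p < 8) :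
    c' p = mainPart c c' p := by
  have h2 := h.even 1 one_ne_zero
  have h4 := h.even 2 two_ne_zero
  have h6 := h.even 3 three_ne_zero
  have h5 := hc.step_pow h 0
  have e1 := mainPart_eq (c := c) (c' := c') (K := 0) (q := 0) (by norm_num) (by norm_num)
  have e2 := mainPart_even c c' (k := 0) (n := 0) (by norm_num)
  have e4 := mainPart_even c c' (k := 1) (n := 0) (by norm_num)
  have e6 := mainPart_even c c' (k := 1) (n := 1) (by norm_num)
  have e5 := mainPart_odd c c' (k := 1) (n := 0) (by norm_num) (by norm_num)
  have e7 := mainPart_odd c c' (k := 1) (n := 1) (by norm_num) (by norm_num)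
  norm_num [hc.zero, hc.one] at h2 h4 h6 h5 e1 e2 e4 e5 e6 e7
  interval_cases p
  · rw [h.one, e1]
  · rw [h2, e2]
  · simp [mainPart]
  · rw [h4, e4]
  · rw [h5, e5]
  · rw [h6, e6]
  · rw [h.seven, e7]

/-- The square of the norm of the block of `mainPart` with second leading digit at `l`. -/
theorem sum_mainPart_zero (hc : Admissible c) (h : WalshStep c c') (L : ℕ) :
    ∑ K ∈ Finset.Ico 1 L, ∑ q ∈ Finset.Ico (2 ^ 0) (2 ^ (0 + 1)), mainPart c c' (2 ^ K + q) ^ 2 ≤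
      (7 / 9) ^ 2 := by
  have hs : ∀ K, ∑ q ∈ Finset.Ico (2 ^ 0) (2 ^ (0 + 1)), mainPart c c' (2 ^ K + q) ^ 2 =
      mainPart c c' (2 ^ K + 1) ^ 2 := fun K => by simp
  simp only [hs]
  -- (13/18)² + ∑_{K ≥ 2} 4^{-K} = 169/324 + 27/324 = (7/9)².
  have h3 : mainPart c c' (2 ^ 1 + 1) ^ 2 ≤ 169 / 324 := by
    have h3 := hc.step_three h
    simp only [mainPart]
    norm_num
    rw [← sq_abs]
    nlinarith [abs_nonneg (c' 3)]
  have hK : ∀ i, mainPart c c' (2 ^ (i + 2) + 1) ^ 2 = 1 / 16 * (1 / 4) ^ i := fun i => by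
    have hp : 0 < 2 ^ i := by positivity
    rw [mainPart_eq (by rw [pow_add]; omega) (by rw [pow_add]; omega)]
    simp only [Nat.one_mod, if_true]
    rw [show 1 / 2 = 0 from rfl, hc.zero, mul_one, neg_sq, ← pow_mul, mul_comm, pow_mul, pow_add]
    norm_num
    ring
  rcases L with _ | _ | L
  · norm_num
  · norm_num
  rw [Finset.sum_Ico_eq_sum_range, show L + 1 + 1 - 1 = L + 1 by omega, Finset.sum_range_succ']
  have e : ∀ i, 1 + (i + 1) = i + 2 := fun i => by ring
  simp only [e, hK, add_zero]
  rw [← Finset.mul_sum]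
  linarith [sum_geom_le L]

/-- For fixed K the halves q / 2 of the odd q run once through level j, with squared weight 4^{-K};
and ∑_{K ≥ j+2} 4^{-K} = 4^{-j}/12. -/
theorem sum_mainPart_succ (c c' : ℕ → ℝ) (j L : ℕ) :
    ∑ K ∈ Finset.Ico (j + 2) L, ∑ q ∈ Finset.Ico (2 ^ (j + 1)) (2 ^ (j + 2)),
      mainPart c c' (2 ^ K + q) ^ 2 ≤
      1 / 12 * (1 / 4) ^ j * ∑ n ∈ Finset.Ico (2 ^ j) (2 ^ (j + 1)), c n ^ 2 := by
  have h1 : ∀ K ∈ Finset.Ico (j + 2) L, ∑ q ∈ Finset.Ico (2 ^ (j + 1)) (2 ^ (j + 2)),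
      mainPart c c' (2 ^ K + q) ^ 2 =
      (1 / 4) ^ K * ∑ n ∈ Finset.Ico (2 ^ j) (2 ^ (j + 1)), c n ^ 2 := by
    intro K hK
    rw [Finset.mem_Ico] at hK
    have hp : 0 < 2 ^ j := by positivity
    have hle : 4 * 2 ^ j ≤ 2 ^ K := by
      calc 4 * 2 ^ j = 2 ^ (j + 2) := by ring
        _ ≤ 2 ^ K := Nat.pow_le_pow_right two_pos hK.1
    rw [sum_level_succ fun q => mainPart c c' (2 ^ K + q) ^ 2, sum_level, Finset.mul_sum]
    refine Finset.sum_congr rfl fun n hn => ?_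
    rw [Finset.mem_range] at hn
    rw [mainPart_eq (by omega) (by omega), mainPart_eq (by omega) (by omega), if_neg (by omega),
      if_pos (by omega), show (1 + 2 * (2 ^ j + n)) / 2 = 2 ^ j + n by omega,
      show (1 / 4 : ℝ) = 1 / 2 * (1 / 2) by norm_num, mul_pow (1 / 2 : ℝ) (1 / 2)]
    ring
  rw [Finset.sum_congr rfl h1, ← Finset.sum_mul]
  refine mul_le_mul_of_nonneg_right ?_ (Finset.sum_nonneg fun _ _ => sq_nonneg _)
  rw [Finset.sum_Ico_eq_sum_range]
  simp only [pow_add]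
  rw [← Finset.mul_sum]
  have : (0 : ℝ) ≤ (1 / 4) ^ j := by positivity
  nlinarith [sum_geom_le (L - (j + 2))]

/-- Bounds for the blocks of `mainPart`. -/
noncomputable def mainBound : ℕ → ℝ
  | 0 => 7 / 9
  | 1 => 0
  | j + 2 => 1 / √3 * (1 / 4) ^ (j + 1)

theorem mainBound_nonneg (l : ℕ) : 0 ≤ mainBound l := by
  rcases l with _ | _ | l <;> simp only [mainBound] <;> positivity

/-- The block l = 1 only sees c 1 = 0. For l = j + 1 with j ≥ 1 the level bound gives (1/12) 4^{-j}
· 4 · 4^{-j} = (4^{-j}/√3)². -/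
theorem sum_mainPart_le (hc : Admissible c) (h : WalshStep c c') (l L : ℕ) :
    ∑ K ∈ Finset.Ico (l + 1) L, ∑ q ∈ Finset.Ico (2 ^ l) (2 ^ (l + 1)),
      mainPart c c' (2 ^ K + q) ^ 2 ≤ mainBound l ^ 2 := by
  rcases l with _ | _ | l
  · exact hc.sum_mainPart_zero h L
  · refine (sum_mainPart_succ c c' 0 L).trans ?_
    norm_num [hc.one, mainBound]
  · refine (sum_mainPart_succ c c' (l + 1) L).trans ?_
    have h1 := hc.level (l + 1)
    refine (mul_le_mul_of_nonneg_left h1 (by positivity)).trans (le_of_eq ?_)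
    simp only [mainBound]
    have hs : (1 / √3) ^ 2 = (1 / 3 : ℝ) := by
      rw [div_pow, Real.sq_sqrt (by norm_num), one_pow]
    rw [mul_pow (1 / √3), hs]
    ring

/-- Bounds for the levels of the difference of the coefficients and `mainPart`. -/
noncomputable def restBound : ℕ → ℝ
  | 0 => 0
  | 1 => 0
  | 2 => 0
  | i + 3 => (1 / 4) ^ (i + 2) / 3

theorem restBound_nonneg (l : ℕ) : 0 ≤ restBound l := by
  rcases l with _ | _ | _ | l <;> simp only [restBound] <;> positivity

theorem sum_rest_le (hc : Admissible c) (h : WalshStep c c') (K : ℕ) :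
    ∑ p ∈ Finset.Ico (2 ^ K) (2 ^ (K + 1)), (c' p - mainPart c c' p) ^ 2 ≤ restBound K ^ 2 := by
  have h0 : ∀ K, K < 3 → ∑ p ∈ Finset.Ico (2 ^ K) (2 ^ (K + 1)), (c' p - mainPart c c' p) ^ 2 = 0 := by
    intro K hK
    refine Finset.sum_eq_zero fun p hp => ?_
    rw [Finset.mem_Ico] at hp
    have h1 : 0 < 2 ^ K := by positivity
    have h2 : 2 ^ (K + 1) ≤ 2 ^ 3 := Nat.pow_le_pow_right two_pos (by omega)
    rw [hc.eq_mainPart h (by omega) (by omega), sub_self]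
    norm_num
  rcases K with _ | _ | _ | K
  · rw [h0 _ (by norm_num)]; positivity
  · rw [h0 _ (by norm_num)]; positivity
  · rw [h0 _ (by norm_num)]; positivity
  · exact hc.sum_sub_mainPart_sq_le h (k := K + 2) (by omega)

/-- The decisive count: 7/9 + (1/√3)(1/3) + 1/36 is about 0.998. -/
theorem sum_bounds_le (L : ℕ) :
    ∑ l ∈ Finset.range (L + 3), mainBound l + ∑ K ∈ Finset.range (L + 3), restBound K ≤
      999 / 1000 := by
  rw [Finset.sum_range_succ', Finset.sum_range_succ', Finset.sum_range_succ' restBound,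
    Finset.sum_range_succ' (fun k => restBound (k + 1)),
    Finset.sum_range_succ' (fun k => restBound (k + 1 + 1))]
  simp only [mainBound, restBound]
  have e1 : ∀ k, 1 / √3 * (1 / 4 : ℝ) ^ (k + 1) = 1 / √3 * (1 / 4) * (1 / 4) ^ k := fun k => by ring
  have e2 : ∀ k, (1 / 4 : ℝ) ^ (k + 2) / 3 = 1 / 48 * (1 / 4) ^ k := fun k => by ring
  simp only [e1, e2]
  rw [← Finset.mul_sum, ← Finset.mul_sum]
  have h3 : 1 / √3 ≤ 578 / 1000 := by
    rw [div_le_iff₀ (by positivity)]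
    have : (1.731 : ℝ) ≤ √3 := Real.le_sqrt_of_sq_le (by norm_num)
    linarith
  have h4 := sum_geom_le L
  have h5 := sum_geom_le (L + 1)
  have h6 : 0 ≤ ∑ i ∈ Finset.range (L + 1), (1 / 4 : ℝ) ^ i :=
    Finset.sum_nonneg fun _ _ => by positivity
  have h7 : 1 / √3 * (1 / 4) * ∑ i ∈ Finset.range (L + 1), (1 / 4 : ℝ) ^ i ≤
      578 / 1000 * (1 / 4) * (4 / 3) :=
    mul_le_mul (by linarith) h5 h6 (by norm_num)
  linarith

end Admissible

/-! ### Operator bounds from the block decomposition. -/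

section Shift

variable {𝕜 : Type*} [RCLike 𝕜] {H : Type*} [NormedAddCommGroup H] [InnerProductSpace 𝕜 H]

theorem lt_of_two_pow_add_lt {K q L : ℕ} (h : 2 ^ K + q < 2 ^ L) : K < L :=
  (Nat.pow_lt_pow_iff_right one_lt_two).mp (lt_of_le_of_lt (Nat.le_add_right _ _) h)

theorem two_pow_log_add {p : ℕ} (hp : p ≠ 0) :
    2 ^ Nat.log 2 p + (p - 2 ^ Nat.log 2 p) = p ∧ p - 2 ^ Nat.log 2 p < 2 ^ Nat.log 2 p := by
  have h1 := Nat.pow_log_le_self 2 hp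
  have h2 := Nat.lt_pow_succ_log_self one_lt_two p
  rw [pow_succ] at h2
  omega

theorem shiftBound_main {e : ℕ → H} (he : Orthonormal 𝕜 e) {c c' : ℕ → ℝ} (hc : Admissible c)
    (h : WalshStep c c') (L l : ℕ) :
    ShiftBound 𝕜 e L (fun p => if p - 2 ^ Nat.log 2 p ≠ 0 ∧ Nat.log 2 (p - 2 ^ Nat.log 2 p) = l
      then mainPart c c' p else 0) (Admissible.mainBound l) := by
  refine ShiftBound.of_injOn he (Admissible.mainBound_nonneg l)
    ((Finset.Ico (l + 1) L ×ˢ Finset.Ico (2 ^ l) (2 ^ (l + 1))).image fun i => 2 ^ i.1 + i.2)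
    (fun p hp hP => ?_) (fun n n' p hp p' hp' hnp => ?_) ?_
  · refine if_neg fun hl => hP ?_
    rw [Finset.mem_Ico] at hp
    obtain ⟨h1, h2⟩ := two_pow_log_add (p := p) (by omega)
    have h3 := Nat.pow_log_le_self 2 hl.1
    have h4 := Nat.lt_pow_succ_log_self one_lt_two (p - 2 ^ Nat.log 2 p)
    rw [hl.2] at h3 h4
    refine Finset.mem_image.mpr ⟨(Nat.log 2 p, p - 2 ^ Nat.log 2 p), ?_, h1⟩
    rw [Finset.mem_product, Finset.mem_Ico, Finset.mem_Ico]
    refine ⟨⟨?_, lt_of_two_pow_add_lt (h1.trans_lt hp.2)⟩, h3, h4⟩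
    exact (Nat.pow_lt_pow_iff_right one_lt_two).mp (h3.trans_lt h2)
  · obtain ⟨⟨K, q⟩, hi, rfl⟩ := Finset.mem_image.mp hp
    obtain ⟨⟨K', q'⟩, hi', rfl⟩ := Finset.mem_image.mp hp'
    rw [Finset.mem_product] at hi hi'
    exact append_inj_of_second_log_eq hi.2 hi'.2 (Finset.mem_Ico.mp hi.1).1
      (Finset.mem_Ico.mp hi'.1).1 hnp
  · have hlt : ∀ i ∈ Finset.Ico (l + 1) L ×ˢ Finset.Ico (2 ^ l) (2 ^ (l + 1)), i.2 < 2 ^ i.1 := by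
      intro i hi
      rw [Finset.mem_product, Finset.mem_Ico, Finset.mem_Ico] at hi
      exact hi.2.2.trans_le (Nat.pow_le_pow_right two_pos hi.1.1)
    rw [Finset.sum_image, Finset.sum_product]
    · refine le_trans (Finset.sum_le_sum fun K _ => Finset.sum_le_sum fun q _ => ?_)
        (hc.sum_mainPart_le h l L)
      split_ifs
      · exact le_rfl
      · norm_num
        positivity
    · intro i hi j hj hij
      have h1 := congrArg (Nat.log 2) hij
      simp only [log_two_pow_add (hlt i hi), log_two_pow_add (hlt j hj)] at h1
      simp only [h1] at hij
      exact Prod.ext h1 (by omega)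

theorem shiftBound_rest {e : ℕ → H} (he : Orthonormal 𝕜 e) {c c' : ℕ → ℝ} (hc : Admissible c)
    (h : WalshStep c c') (L K : ℕ) :
    ShiftBound 𝕜 e L (fun p => if Nat.log 2 p = K then c' p - mainPart c c' p else 0)
      (Admissible.restBound K) := by
  have hlog : ∀ p ∈ Finset.Ico (2 ^ K) (2 ^ (K + 1)), p ≠ 0 ∧ Nat.log 2 p = K := fun p hp => by
    rw [Finset.mem_Ico] at hp
    have : 0 < 2 ^ K := by positivity
    exact ⟨by omega, Nat.log_eq_of_pow_le_of_lt_pow hp.1 hp.2⟩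
  refine ShiftBound.of_injOn he (Admissible.restBound_nonneg K)
    (Finset.Ico (2 ^ K) (2 ^ (K + 1)))
    (fun p hp hP => if_neg fun hl => hP ?_) (fun n n' p hp p' hp' hnp => ?_) ?_
  · rw [Finset.mem_Ico] at hp ⊢
    subst hl
    exact ⟨Nat.pow_log_le_self 2 (by omega), Nat.lt_pow_succ_log_self one_lt_two p⟩
  · refine append_inj_of_log_eq (hlog p hp).1 (hlog p' hp').1 ?_ hnp
    rw [(hlog p hp).2, (hlog p' hp').2]
  · refine le_trans (le_of_eq (Finset.sum_congr rfl fun p hp => ?_)) (hc.sum_rest_le h K)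
    rw [if_pos (hlog p hp).2]

theorem Admissible.shiftBound {e : ℕ → H} (he : Orthonormal 𝕜 e) {c c' : ℕ → ℝ}
    (hc : Admissible c) (h : WalshStep c c') (L : ℕ) :
    ShiftBound 𝕜 e (L + 3) c' (999 / 1000) := by
  refine ((ShiftBound.sum (Finset.range (L + 3)) fun l _ => shiftBound_main he hc h (L + 3) l).add
    (ShiftBound.sum (Finset.range (L + 3)) fun K _ => shiftBound_rest he hc h (L + 3) K)).congr
    (fun p hp => ?_) (Admissible.sum_bounds_le L)
  rw [Finset.mem_Ico] at hp
  obtain ⟨h1, h2⟩ := two_pow_log_add (p := p) (by omega)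
  have hK : Nat.log 2 p < L + 3 := lt_of_two_pow_add_lt (h1.trans_lt hp.2)
  rw [Finset.sum_ite_eq, if_pos (Finset.mem_range.mpr hK)]
  -- A power of two has no second leading digit and belongs to no main block; `mainPart` vanishes
  -- there.
  by_cases hq : p - 2 ^ Nat.log 2 p = 0
  · have hm : mainPart c c' p = 0 := by
      unfold mainPart
      rw [hq, if_neg, if_neg (by norm_num)]
      rintro rfl
      have : Nat.log 2 3 = 1 := by simp [Nat.log_eq_iff]
      rw [this] at hq
      omega
    simp [hq, hm]
  · have hl : Nat.log 2 (p - 2 ^ Nat.log 2 p) < L + 3 := by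
      refine lt_of_le_of_lt (Nat.log_mono_right ?_) hK
      omega
    simp only [ne_eq, hq, not_false_eq_true, true_and]
    rw [Finset.sum_ite_eq, if_pos (Finset.mem_range.mpr hl)]
    ring

end Shift

/-! ### Walsh coefficients of the wavelets -/

theorem wavelet_bit (m : ℕ) (a : Bool) {n : ℕ} (hn : n ≠ 0) :
    wavelet m (Nat.bit a n) = opW a (wavelet m n) := by
  have h0 : Nat.bit a n ≠ 0 := by
    rw [Nat.bit_val]
    omega
  have hl : Nat.log 2 (Nat.bit a n) = Nat.log 2 n + 1 := by
    rw [Nat.log_of_one_lt_of_le one_lt_two (by rw [Nat.bit_val]; omega), Nat.bit_div_two]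
  ext t
  have ht : (2 : ℝ) ^ (Nat.log 2 n + 1 + 1) * t = 2 ^ (Nat.log 2 n + 1) * (2 * t) := by
    rw [pow_succ _ (Nat.log 2 n + 1), mul_assoc]
  cases a
  · simp only [wavelet, if_neg h0, hl, walsh_bit, opW, if_neg hn, ht]
  · simp only [wavelet, if_neg h0, hl, walsh_bit, opW, if_neg hn, ht]
    ring

theorem wavelet_one (m : ℕ) : wavelet m 1 = opW true (rho m) := by
  ext t
  simp [wavelet, walsh_one, opW, mul_comm]

theorem wavelet_induction (m : ℕ) {P : ℕ → (ℝ → ℝ) → Prop} (h1 : P 1 (opW true (rho m)))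
    (h2 : ∀ a n, n ≠ 0 → P n (wavelet m n) → P (Nat.bit a n) (opW a (wavelet m n))) {n : ℕ}
    (hn : n ≠ 0) : P n (wavelet m n) := by
  induction n using Nat.binaryRec with
  | zero => exact absurd rfl hn
  | bit a n ih =>
    by_cases h0 : n = 0
    · subst h0
      cases a
      · exact absurd rfl hn
      · rw [show Nat.bit true 0 = 1 from rfl, wavelet_one]
        exact h1
    · rw [wavelet_bit m a h0]
      exact h2 a n h0 (ih h0)

theorem wavelet_periodic_bddMeas (m : ℕ) {n : ℕ} (hn : n ≠ 0) :
    Function.Periodic (wavelet m n) 1 ∧ BddMeas (wavelet m n) :=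
  wavelet_induction m (P := fun _ f => Function.Periodic f 1 ∧ BddMeas f)
    ⟨opW_periodic true (rho_periodic m), (BddMeas.rho m).opW true⟩
    (fun a _ _ h => ⟨opW_periodic a h.1, h.2.opW a⟩) hn

theorem wavelet_zero (m : ℕ) : wavelet m 0 = fun _ => 1 := by
  ext t
  simp [wavelet]

theorem BddMeas.wavelet (m n : ℕ) : BddMeas (wavelet m n) := by
  by_cases hn : n = 0
  · subst hn
    rw [wavelet_zero]
    exact ⟨measurable_const, 1, by simp⟩
  · exact (wavelet_periodic_bddMeas m hn).2

theorem append_bit (a : Bool) {n : ℕ} (hn : n ≠ 0) (p : ℕ) :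
    append (Nat.bit a n) p = Nat.bit a (append n p) := by
  have h0 : Nat.bit a n ≠ 0 := by
    rw [Nat.bit_val]
    omega
  unfold append
  rw [Nat.size_bit h0]
  simp only [Nat.bit_val, Nat.succ_eq_add_one]
  ring

theorem append_one (p : ℕ) : append 1 p = Nat.bit true p := by
  simp [append, Nat.bit_val, add_comm]

theorem walshCoeff_wavelet (m : ℕ) {n : ℕ} (hn : n ≠ 0) :
    (∀ p, walshCoeff (wavelet m n) (append n p) = walshCoeff (rho m) p) ∧
      ∀ M, M ∉ Set.range (append n) → walshCoeff (wavelet m n) M = 0 := by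
  induction n using Nat.binaryRec with
  | zero => exact absurd rfl hn
  | bit a n ih =>
    by_cases h0 : n = 0
    · subst h0
      cases a
      · exact absurd rfl hn
      rw [show Nat.bit true 0 = 1 from rfl, wavelet_one]
      refine ⟨fun p => ?_, fun M hM => ?_⟩
      · rw [append_one, walshCoeff_opW _ _ (rho_periodic m) (BddMeas.rho m), if_pos rfl]
      · obtain ⟨b, M, rfl⟩ : ∃ b n', M = Nat.bit b n' :=
          ⟨M.bodd, M.div2, (Nat.bit_bodd_div2 M).symm⟩
        rw [walshCoeff_opW _ _ (rho_periodic m) (BddMeas.rho m), if_neg]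
        rintro rfl
        exact hM ⟨M, append_one M⟩
    · obtain ⟨hp, hb⟩ := wavelet_periodic_bddMeas m h0
      rw [wavelet_bit m a h0]
      refine ⟨fun p => ?_, fun M hM => ?_⟩
      · rw [append_bit a h0, walshCoeff_opW _ _ hp hb, if_pos rfl, (ih h0).1]
      · obtain ⟨b, M, rfl⟩ : ∃ b n', M = Nat.bit b n' :=
          ⟨M.bodd, M.div2, (Nat.bit_bodd_div2 M).symm⟩
        rw [walshCoeff_opW _ _ hp hb]
        split_ifs with hab
        · subst hab
          refine (ih h0).2 M fun ⟨p, hp⟩ => hM ⟨p, ?_⟩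
          rw [append_bit a h0, hp]
        · rfl

/-! ### Completeness of the Walsh system -/

/-- Testing with W_0 w_n and W_1 w_n gives the sum and the difference of the integrals over the two
halves, so both vanish. Rescaled to (0,1), each half of f satisfies the same hypotheses with one
dyadic level less to treat. -/
theorem integral_dyadic_eq_zero {E : Type*} [NormedAddCommGroup E] [NormedSpace ℝ E]
    (k : ℕ) {f : ℝ → E} (hi : IntervalIntegrable f volume 0 1)
    (hf : ∀ n, ∫ t in (0 : ℝ)..1, walsh n t • f t = 0) {j : ℕ} (hj : j ≤ 2 ^ k) :
    ∫ t in (0 : ℝ)..(j / 2 ^ k), f t = 0 := by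
  induction k generalizing f j with
  | zero =>
    have h1 := hf 0
    simp only [walsh_zero, one_smul] at h1
    rw [pow_zero] at hj
    interval_cases j
    · simp
    · simpa using h1
  | succ k ih =>
    have hsub1 : Set.uIcc (0 : ℝ) (1 / 2) ⊆ Set.uIcc 0 1 := by
      rw [Set.uIcc_of_le (by norm_num), Set.uIcc_of_le (by norm_num)]
      exact Set.Icc_subset_Icc le_rfl (by norm_num)
    have hsub2 : Set.uIcc (1 / 2 : ℝ) 1 ⊆ Set.uIcc 0 1 := by
      rw [Set.uIcc_of_le (by norm_num), Set.uIcc_of_le (by norm_num)]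
      exact Set.Icc_subset_Icc (by norm_num) le_rfl
    have hi1 := hi.mono_set hsub1
    have hi2 := hi.mono_set hsub2
    have hw : ∀ {a b : ℝ} (n : ℕ), IntervalIntegrable f volume a b →
        IntervalIntegrable (fun t => walsh n t • f t) volume a b := by
      intro a b n h
      refine h.mono_fun ((measurable_walsh n).aestronglyMeasurable.smul
        (h.aestronglyMeasurable_restrict_uIoc)) (Filter.Eventually.of_forall fun t => ?_)
      simp only [norm_smul]
      exact mul_le_of_le_one_left (norm_nonneg _) (abs_walsh_le n t)
    have hsplit : ∀ n, (∫ t in (0 : ℝ)..(1 / 2), walsh n (2 * t) • f t) = 0 ∧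
        (∫ t in (1 / 2 : ℝ)..1, walsh n (2 * t) • f t) = 0 := by
      intro n
      have key : ∀ a : Bool, (∫ t in (0 : ℝ)..(1 / 2), walsh n (2 * t) • f t) +
          (if a then (-1 : ℝ) else 1) • (∫ t in (1 / 2 : ℝ)..1, walsh n (2 * t) • f t) = 0 := by
        intro a
        rw [← hf (Nat.bit a n), ← intervalIntegral.integral_add_adjacent_intervals (hw _ hi1)
          (hw _ hi2), walsh_bit, ← intervalIntegral.integral_smul]
        congr 1
        · refine intervalIntegral.integral_congr_Ioo_of_le (by norm_num) fun t ht => ?_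
          cases a
          · rfl
          · simp [opW, rad_of_mem_Ioo ht]
        · refine intervalIntegral.integral_congr_Ioo_of_le (by norm_num) fun t ht => ?_
          cases a
          · simp [opW]
          · simp [opW, rad_of_mem_Ioo' ht]
      have h0 := key false
      have h1 := key true
      simp only [Bool.false_eq_true, if_false, if_true, one_smul, neg_smul] at h0 h1
      have h2 : (2 : ℝ) • (∫ t in (0 : ℝ)..(1 / 2), walsh n (2 * t) • f t) = 0 := by
        rw [two_smul]
        nth_rewrite 1 [eq_neg_of_add_eq_zero_left h0]
        rw [eq_neg_of_add_eq_zero_left h1, neg_neg, neg_add_cancel]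
      have h3 := (smul_eq_zero.mp h2).resolve_left two_ne_zero
      rw [h3, zero_add] at h0
      exact ⟨h3, h0⟩
    have hf0 : ∀ n, ∫ t in (0 : ℝ)..1, walsh n t • f (2⁻¹ * t) = 0 := by
      intro n
      have h := intervalIntegral.integral_comp_mul_left (a := 0) (b := 1)
        (fun t => walsh n (2 * t) • f t) (c := (2⁻¹ : ℝ)) (by norm_num)
      simp only [mul_inv_cancel_left₀ (two_ne_zero' ℝ), mul_zero, mul_one] at h
      rw [h, ← one_div 2, (hsplit n).1, smul_zero]
    have hf1 : ∀ n, ∫ t in (0 : ℝ)..1, walsh n t • f (2⁻¹ * (t + 1)) = 0 := by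
      intro n
      have h := intervalIntegral.integral_comp_mul_add (a := 0) (b := 1)
        (fun t => walsh n (2 * t) • f t) (c := (2⁻¹ : ℝ)) (by norm_num) 2⁻¹
      have e : ∀ t : ℝ, 2⁻¹ * t + 2⁻¹ = 2⁻¹ * (t + 1) := fun t => by ring
      simp only [e, mul_inv_cancel_left₀ (two_ne_zero' ℝ), walsh_periodic n _] at h
      rw [h]
      norm_num
      exact (hsplit n).2
    have hi0 : IntervalIntegrable (fun t => f (2⁻¹ * t)) volume 0 1 := by
      have := hi1.comp_mul_left (c := (2⁻¹ : ℝ))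
      norm_num at this
      simpa only [one_div] using this
    have hi1' : IntervalIntegrable (fun t => f (2⁻¹ * (t + 1))) volume 0 1 := by
      have := (hi2.comp_mul_left (c := (2⁻¹ : ℝ))).comp_add_right 1
      norm_num at this
      simpa only [one_div] using this
    have h2k : (0 : ℝ) < 2 ^ k := by positivity
    have hleft : ∀ i : ℕ, i ≤ 2 ^ k → ∫ t in (0 : ℝ)..(i / 2 ^ (k + 1)), f t = 0 := by
      intro i hi
      have h := ih hi0 hf0 hi
      rw [intervalIntegral.integral_comp_mul_left _ (by norm_num)] at h
      have h' := (smul_eq_zero.mp h).resolve_left (by norm_num)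
      rw [mul_zero] at h'
      rw [← h']
      congr 1
      rw [pow_succ]
      field_simp
    rcases le_total j (2 ^ k) with hle | hle
    · exact hleft j hle
    · obtain ⟨i, rfl⟩ := Nat.exists_eq_add_of_le hle
      have hi' : i ≤ 2 ^ k := by rw [pow_succ] at hj; omega
      have h := ih hi1' hf1 hi'
      have e : ∀ t : ℝ, 2⁻¹ * (t + 1) = 2⁻¹ * t + 2⁻¹ := fun t => by ring
      simp only [e] at h
      rw [intervalIntegral.integral_comp_mul_add _ (by norm_num)] at h
      have h' := (smul_eq_zero.mp h).resolve_left (by norm_num)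
      have h0 := hleft (2 ^ k) le_rfl
      have e1 : ((2 ^ k : ℕ) : ℝ) / 2 ^ (k + 1) = 1 / 2 := by
        rw [pow_succ]; push_cast; field_simp
      have e2 : (2⁻¹ : ℝ) * (i / 2 ^ k) + 2⁻¹ = ((2 ^ k + i : ℕ) : ℝ) / 2 ^ (k + 1) := by
        rw [pow_succ]; push_cast; field_simp; ring
      rw [e2, mul_zero, zero_add, ← one_div] at h'
      rw [e1] at h0
      have hmem : ((2 ^ k + i : ℕ) : ℝ) / 2 ^ (k + 1) ∈ Set.Icc (1 / 2 : ℝ) 1 := by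
        rw [← e2]
        have hle1 : (i : ℝ) / 2 ^ k ≤ 1 := by
          rw [div_le_one h2k]
          exact_mod_cast hi'
        have : (0 : ℝ) ≤ i / 2 ^ k := by positivity
        constructor <;> linarith
      rw [← intervalIntegral.integral_add_adjacent_intervals hi1
        (hi2.mono_set ?_), h0, h', zero_add]
      rw [Set.uIcc_of_le hmem.1, Set.uIcc_of_le (by norm_num)]
      exact Set.Icc_subset_Icc le_rfl hmem.2

/-- The primitive of f vanishes at dyadic points, hence on [0,1] by continuity; Lebesgue
differentiation recovers f. -/
theorem ae_eq_zero_of_integral_walsh {E : Type*} [NormedAddCommGroup E] [NormedSpace ℝ E]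
    [CompleteSpace E] {f : ℝ → E} (hi : IntervalIntegrable f volume 0 1)
    (hf : ∀ n, ∫ t in (0 : ℝ)..1, walsh n t • f t = 0) :
    ∀ᵐ t ∂volume.restrict (Set.Ioo (0 : ℝ) 1), f t = 0 := by
  have hcont := intervalIntegral.continuousOn_primitive_interval' hi Set.left_mem_uIcc
  rw [Set.uIcc_of_le zero_le_one] at hcont
  have hzero : ∀ x ∈ Set.Icc (0 : ℝ) 1, ∫ t in (0 : ℝ)..x, f t = 0 := by
    intro x hx
    have h2 : Filter.Tendsto (fun k : ℕ => (2 : ℝ) ^ k) Filter.atTop Filter.atTop :=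
      tendsto_pow_atTop_atTop_of_one_lt one_lt_two
    have hfl : Filter.Tendsto (fun k : ℕ => (⌊x * 2 ^ k⌋₊ : ℝ) / 2 ^ k) Filter.atTop (nhds x) :=
      (tendsto_nat_floor_mul_div_atTop hx.1).comp h2
    have hle : ∀ k : ℕ, ⌊x * 2 ^ k⌋₊ ≤ 2 ^ k := fun k => by
      have h1 : (⌊x * 2 ^ k⌋₊ : ℝ) ≤ x * 2 ^ k := Nat.floor_le (mul_nonneg hx.1 (by positivity))
      have h3 : x * 2 ^ k ≤ 1 * (2 : ℝ) ^ k := mul_le_mul_of_nonneg_right hx.2 (by positivity)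
      have : (⌊x * 2 ^ k⌋₊ : ℝ) ≤ ((2 ^ k : ℕ) : ℝ) := by push_cast; linarith
      exact_mod_cast this
    have hmem : ∀ k : ℕ, (⌊x * 2 ^ k⌋₊ : ℝ) / 2 ^ k ∈ Set.Icc (0 : ℝ) 1 := fun k => by
      refine ⟨by positivity, ?_⟩
      rw [div_le_one (by positivity)]
      exact_mod_cast hle k
    have ht := (hcont x hx).tendsto.comp (tendsto_nhdsWithin_iff.mpr
      ⟨hfl, Filter.Eventually.of_forall hmem⟩)
    have h0 : ∀ k : ℕ, ((fun b => ∫ t in (0 : ℝ)..b, f t) ∘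
        fun k : ℕ => (⌊x * 2 ^ k⌋₊ : ℝ) / 2 ^ k) k = 0 :=
      fun k => integral_dyadic_eq_zero k hi hf (hle k)
    exact tendsto_nhds_unique ht (tendsto_const_nhds.congr fun k => (h0 k).symm)
  rw [ae_restrict_iff' measurableSet_Ioo]
  filter_upwards [hi.ae_hasDerivAt_integral] with x hx hx'
  rw [Set.uIcc_of_le zero_le_one] at hx
  have h1 := hx ⟨hx'.1.le, hx'.2.le⟩ 0 ⟨le_rfl, zero_le_one⟩
  have h2 : HasDerivAt (fun x => ∫ t in (0 : ℝ)..x, f t) 0 x := by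
    refine (hasDerivAt_const x (0 : E)).congr_of_eventuallyEq ?_
    filter_upwards [Ioo_mem_nhds hx'.1 hx'.2] with y hy
    exact hzero y ⟨hy.1.le, hy.2.le⟩
  exact h1.unique h2

/-! ### The Walsh functions as an orthonormal basis of `L²(0,1)` -/

section Basis

variable (𝕜 : Type*) [RCLike 𝕜]

/-- The real or complex Hilbert space `L²(0,1)`. -/
noncomputable abbrev L2 := Lp 𝕜 2 (volume.restrict (Set.Ioo (0 : ℝ) 1))

theorem BddMeas.memLp {f : ℝ → ℝ} (hf : BddMeas f) :
    MemLp (fun t => ((f t : ℝ) : 𝕜)) 2 (volume.restrict (Set.Ioo (0 : ℝ) 1)) := by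
  obtain ⟨hm, C, hC⟩ := hf
  refine MemLp.of_bound (RCLike.measurable_ofReal.comp hm).aestronglyMeasurable C
    (Filter.Eventually.of_forall fun t => ?_)
  rw [RCLike.norm_ofReal]
  exact hC t

theorem integral_Ioo_eq {E : Type*} [NormedAddCommGroup E] [NormedSpace ℝ E] (f : ℝ → E) :
    ∫ t, f t ∂volume.restrict (Set.Ioo (0 : ℝ) 1) = ∫ t in (0 : ℝ)..1, f t := by
  rw [intervalIntegral.integral_of_le zero_le_one, integral_Ioc_eq_integral_Ioo]

theorem inner_toLp {f : ℝ → ℝ} (hf : BddMeas f) (g : L2 𝕜) :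
    inner 𝕜 (hf.memLp 𝕜).toLp g = ∫ t in (0 : ℝ)..1, f t • g t := by
  rw [MeasureTheory.L2.inner_def, ← integral_Ioo_eq]
  refine integral_congr_ae ?_
  filter_upwards [(hf.memLp 𝕜).coeFn_toLp] with t ht
  rw [ht, RCLike.inner_apply, RCLike.conj_ofReal, mul_comm, RCLike.real_smul_eq_coe_mul]

theorem inner_toLp_toLp {f g : ℝ → ℝ} (hf : BddMeas f) (hg : BddMeas g) :
    inner 𝕜 (hf.memLp 𝕜).toLp (hg.memLp 𝕜).toLp =
      ((∫ t in (0 : ℝ)..1, f t * g t : ℝ) : 𝕜) := by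
  rw [inner_toLp 𝕜 hf, ← integral_Ioo_eq, ← integral_Ioo_eq, ← integral_ofReal]
  refine integral_congr_ae ?_
  filter_upwards [(hg.memLp 𝕜).coeFn_toLp] with t ht
  rw [ht, RCLike.real_smul_eq_coe_mul, RCLike.ofReal_mul]

/-- The Walsh functions in `L²(0,1)`. -/
noncomputable def walshL2 (n : ℕ) : L2 𝕜 := ((BddMeas.walsh n).memLp 𝕜).toLp

theorem inner_walshL2_toLp {f : ℝ → ℝ} (hf : BddMeas f) (n : ℕ) :
    inner 𝕜 (walshL2 𝕜 n) (hf.memLp 𝕜).toLp = (walshCoeff f n : 𝕜) := by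
  unfold walshL2 walshCoeff
  rw [inner_toLp_toLp 𝕜 (BddMeas.walsh n) hf]
  simp only [mul_comm]

theorem orthonormal_walshL2 : Orthonormal 𝕜 (walshL2 𝕜) := by
  classical
  rw [orthonormal_iff_ite]
  intro m n
  have h := inner_walshL2_toLp 𝕜 (BddMeas.walsh n) m
  rw [walshCoeff_walsh] at h
  refine Eq.trans h ?_
  by_cases hmn : m = n
  · simp [hmn]
  · simp [hmn, Ne.symm hmn]

theorem span_walshL2_orthogonal : (Submodule.span 𝕜 (Set.range (walshL2 𝕜)))ᗮ = ⊥ := by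
  rw [Submodule.eq_bot_iff]
  intro f hf
  have h : ∀ n, ∫ t in (0 : ℝ)..1, walsh n t • f t = 0 := fun n => by
    rw [← inner_toLp 𝕜 (BddMeas.walsh n) f]
    exact (Submodule.mem_orthogonal _ f).mp hf _ (Submodule.subset_span ⟨n, rfl⟩)
  have hi : IntervalIntegrable f volume 0 1 := by
    rw [intervalIntegrable_iff_integrableOn_Ioo_of_le zero_le_one]
    exact (Lp.memLp f).integrable (by norm_num)
  rw [Lp.eq_zero_iff_ae_eq_zero]
  exact ae_eq_zero_of_integral_walsh hi h

/-- The Walsh system as a Hilbert basis. -/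
noncomputable def walshBasis : HilbertBasis ℕ 𝕜 (L2 𝕜) :=
  HilbertBasis.mkOfOrthogonalEqBot (orthonormal_walshL2 𝕜) (span_walshL2_orthogonal 𝕜)

theorem walshBasis_apply (n : ℕ) : walshBasis 𝕜 n = walshL2 𝕜 n := by
  unfold walshBasis
  rw [HilbertBasis.coe_mkOfOrthogonalEqBot]

theorem hasSum_waveletL2 (m : ℕ) {n : ℕ} (hn : n ≠ 0) :
    HasSum (fun p => (walshCoeff (rho m) p : 𝕜) • walshL2 𝕜 (append n p)) (waveletL2 𝕜 m n) := by
  have h := (walshBasis 𝕜).hasSum_repr (waveletL2 𝕜 m n)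
  have hc : ∀ M, (walshBasis 𝕜).repr (waveletL2 𝕜 m n) M =
      (walshCoeff (wavelet m n) M : 𝕜) := fun M => by
    rw [HilbertBasis.repr_apply_apply, walshBasis_apply]
    exact inner_walshL2_toLp 𝕜 (BddMeas.wavelet m n) M
  simp only [hc, walshBasis_apply] at h
  have h2 := ((append_right_injective n).hasSum_iff (f := fun M =>
    (walshCoeff (wavelet m n) M : 𝕜) • walshL2 𝕜 M) fun M hM => by
      rw [(walshCoeff_wavelet m hn).2 M hM]; simp).mpr h
  simpa only [Function.comp_def, (walshCoeff_wavelet m hn).1] using h2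

theorem waveletL2_zero (m : ℕ) : waveletL2 𝕜 m 0 = walshL2 𝕜 0 := by
  unfold waveletL2 walshL2
  congr 1

/-- The coefficient c(0) = 1 cancels w_n, and n = 0 is not perturbed at all. The bound for the
truncations p < 2^{L+3} is independent of L and passes to the limit. -/
theorem norm_sum_smul_sub_le (m : ℕ) (F : Finset ℕ) (x : ℕ → 𝕜) :
    ‖∑ n ∈ F, x n • (waveletL2 𝕜 (m + 1) n - walshL2 𝕜 n)‖ ≤
      999 / 1000 * √(∑ n ∈ F, ‖x n‖ ^ 2) := by
  have h0 : ∀ n, n ≠ 0 → Filter.Tendsto (fun L => ∑ p ∈ Finset.Ico 1 (2 ^ (L + 3)),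
      (walshCoeff (rho (m + 1)) p : 𝕜) • walshL2 𝕜 (append n p)) Filter.atTop
      (nhds (waveletL2 𝕜 (m + 1) n - walshL2 𝕜 n)) := by
    intro n hn
    have h1 := (hasSum_waveletL2 𝕜 (m + 1) hn).tendsto_sum_nat
    have h2 : Filter.Tendsto (fun L : ℕ => 2 ^ (L + 3)) Filter.atTop Filter.atTop :=
      (tendsto_pow_atTop_atTop_of_one_lt one_lt_two).comp (Filter.tendsto_add_atTop_nat 3)
    refine ((h1.comp h2).sub_const (walshL2 𝕜 n)).congr fun L => ?_
    have h3 : append n 0 = n := by simp [append]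
    rw [Function.comp_apply, Finset.range_eq_Ico,
      Finset.sum_eq_sum_Ico_succ_bot (by positivity), walshCoeff_rho_zero, h3]
    simp
  have h1 : ∑ n ∈ F, x n • (waveletL2 𝕜 (m + 1) n - walshL2 𝕜 n) =
      ∑ n ∈ F.erase 0, x n • (waveletL2 𝕜 (m + 1) n - walshL2 𝕜 n) := by
    refine (Finset.sum_subset (Finset.erase_subset _ _) fun n hn hn' => ?_).symm
    have : n = 0 := by
      by_contra h
      exact hn' (Finset.mem_erase.mpr ⟨h, hn⟩)
    rw [this, waveletL2_zero, sub_self, smul_zero]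
  rw [h1]
  have h2 := tendsto_finsetSum (F.erase 0) fun n hn =>
    (h0 n (Finset.ne_of_mem_erase hn)).const_smul (x n)
  refine (le_of_tendsto' h2.norm fun L => (admissible_rho m).shiftBound
    (orthonormal_walshL2 𝕜) (walshStep_rho m) L (F.erase 0) x (Finset.notMem_erase 0 F)).trans ?_
  refine mul_le_mul_of_nonneg_left (Real.sqrt_le_sqrt ?_) (by norm_num)
  exact Finset.sum_le_sum_of_subset_of_nonneg (Finset.erase_subset _ _) fun _ _ _ => sq_nonneg _

end Basis

/-! ### Small perturbations of orthonormal bases -/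

section Perturbation

variable {𝕜 : Type*} [RCLike 𝕜] {H : Type*} [NormedAddCommGroup H] [InnerProductSpace 𝕜 H]

theorem hasSum_norm_sq_repr (b : HilbertBasis ℕ 𝕜 H) (x : H) :
    HasSum (fun n => ‖b.repr x n‖ ^ 2) (‖x‖ ^ 2) := by
  have h := lp.hasSum_norm (p := 2) (by norm_num) (b.repr x)
  rw [b.repr.norm_map] at h
  simpa using h

theorem exists_continuousLinearMap_of_norm_sum_le [CompleteSpace H] (b : HilbertBasis ℕ 𝕜 H) {u : ℕ → H} {q : ℝ}
    (hq : 0 ≤ q) (h : ∀ (F : Finset ℕ) (x : ℕ → 𝕜),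
      ‖∑ n ∈ F, x n • u n‖ ≤ q * √(∑ n ∈ F, ‖x n‖ ^ 2)) :
    ∃ S : H →L[𝕜] H, ‖S‖ ≤ q ∧ ∀ n, S (b n) = u n := by
  have hs : ∀ x : H, Summable fun n => b.repr x n • u n := by
    intro x
    rw [summable_iff_vanishing_norm]
    intro ε hε
    have hε' : 0 < (ε / (q + 1)) ^ 2 := by positivity
    obtain ⟨s, hs⟩ := summable_iff_vanishing_norm.mp (hasSum_norm_sq_repr b x).summable _ hε'
    refine ⟨s, fun t ht => (h t _).trans_lt ?_⟩
    have h1 := hs t ht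
    rw [Real.norm_of_nonneg (Finset.sum_nonneg fun _ _ => sq_nonneg _)] at h1
    have h2 : √(∑ n ∈ t, ‖b.repr x n‖ ^ 2) < ε / (q + 1) :=
      (Real.sqrt_lt' (by positivity)).mpr h1
    calc q * √(∑ n ∈ t, ‖b.repr x n‖ ^ 2) ≤ (q + 1) * √(∑ n ∈ t, ‖b.repr x n‖ ^ 2) :=
          mul_le_mul_of_nonneg_right (by linarith) (Real.sqrt_nonneg _)
      _ < (q + 1) * (ε / (q + 1)) := mul_lt_mul_of_pos_left h2 (by linarith)
      _ = ε := by field_simp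
  let S₀ : H →ₗ[𝕜] H :=
    { toFun := fun x => ∑' n, b.repr x n • u n
      map_add' := fun x y => by
        rw [← (hs x).tsum_add (hs y)]
        simp only [map_add, lp.coeFn_add, Pi.add_apply, add_smul]
      map_smul' := fun c x => by
        rw [RingHom.id_apply, ← (hs x).tsum_const_smul c]
        simp only [map_smul, lp.coeFn_smul, Pi.smul_apply, smul_assoc] }
  have hb : ∀ x, ‖S₀ x‖ ≤ q * ‖x‖ := by
    intro x
    refine le_of_tendsto' (hs x).hasSum.norm fun F => (h F _).trans ?_
    refine mul_le_mul_of_nonneg_left ?_ hq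
    rw [← Real.sqrt_sq (norm_nonneg x)]
    exact Real.sqrt_le_sqrt (sum_le_hasSum F (fun _ _ => sq_nonneg _) (hasSum_norm_sq_repr b x))
  refine ⟨S₀.mkContinuous q hb, LinearMap.mkContinuous_norm_le _ hq _, fun n => ?_⟩
  classical
  change ∑' k, b.repr (b n) k • u k = u n
  rw [tsum_eq_single n fun k hk => ?_]
  · rw [b.repr_self, lp.single_apply_self, one_smul]
  · rw [b.repr_self, lp.single_apply_ne _ _ _ hk, zero_smul]

/-- Neumann series: T = 1 + S, where S sends b n to v n - b n and ‖S‖ ≤ q < 1. -/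
theorem exists_equiv_of_norm_sum_le [CompleteSpace H] (b : HilbertBasis ℕ 𝕜 H) {v : ℕ → H} {q : ℝ}
    (hq : 0 ≤ q) (hq1 : q < 1) (h : ∀ (F : Finset ℕ) (x : ℕ → 𝕜),
      ‖∑ n ∈ F, x n • (v n - b n)‖ ≤ q * √(∑ n ∈ F, ‖x n‖ ^ 2)) :
    ∃ T : H ≃L[𝕜] H, (∀ n, v n = T (b n)) ∧ ∀ x, ‖T x - x‖ ≤ q * ‖x‖ := by
  obtain ⟨S, hS, hSb⟩ := exists_continuousLinearMap_of_norm_sum_le b hq h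
  have hn : ‖-S‖ < 1 := by rw [norm_neg]; exact hS.trans_lt hq1
  have hT : ∀ x, ContinuousLinearEquiv.unitsEquiv 𝕜 H (Units.oneSub (-S) hn) x = x + S x := by
    intro x
    rw [ContinuousLinearEquiv.unitsEquiv_apply, Units.val_oneSub]
    simp
  refine ⟨ContinuousLinearEquiv.unitsEquiv 𝕜 H (Units.oneSub (-S) hn), fun n => ?_, fun x => ?_⟩
  · rw [hT, hSb]
    abel
  · rw [hT, add_sub_cancel_left]
    exact (S.le_opNorm x).trans (mul_le_mul_of_nonneg_right hS (norm_nonneg x))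

end Perturbation

/-! ### The Riesz basis property and uniform Riesz bounds. -/

section RieszBasis

variable (𝕜 : Type*) [RCLike 𝕜]

theorem exists_equiv_waveletL2 {m : ℕ} (hm : 1 ≤ m) : ∃ T : L2 𝕜 ≃L[𝕜] L2 𝕜,
    (∀ n, waveletL2 𝕜 m n = T (walshBasis 𝕜 n)) ∧ ∀ x, ‖T x - x‖ ≤ 999 / 1000 * ‖x‖ := by
  obtain ⟨m, rfl⟩ := Nat.exists_eq_add_of_le' hm
  refine exists_equiv_of_norm_sum_le (walshBasis 𝕜) (by norm_num) (by norm_num) fun F x => ?_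
  simp only [walshBasis_apply]
  exact norm_sum_smul_sub_le 𝕜 m F x

theorem isRieszBasis_waveletL2 {m : ℕ} (hm : 1 ≤ m) : IsRieszBasis 𝕜 (waveletL2 𝕜 m) := by
  obtain ⟨T, hT, -⟩ := exists_equiv_waveletL2 𝕜 hm
  exact ⟨walshBasis 𝕜, T, hT⟩

theorem isRieszBounds_waveletL2 {m : ℕ} (hm : 1 ≤ m) :
    IsRieszBounds 𝕜 (1 / 1000) (1999 / 1000) (waveletL2 𝕜 m) := by
  obtain ⟨T, hT, hq⟩ := exists_equiv_waveletL2 𝕜 hm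
  refine ⟨by norm_num, by norm_num, fun c => ?_⟩
  have hc : ‖(walshBasis 𝕜).repr.symm c‖ = ‖c‖ := (walshBasis 𝕜).repr.symm.norm_map c
  have h1 := hq ((walshBasis 𝕜).repr.symm c)
  rw [hc] at h1
  refine ⟨T ((walshBasis 𝕜).repr.symm c), ?_, ?_, ?_⟩
  · have h := ((walshBasis 𝕜).hasSum_repr_symm c).mapL (T : L2 𝕜 →L[𝕜] L2 𝕜)
    convert! h using 1
    ext1 n
    rw [hT n]
    simp
  · have h2 := norm_sub_norm_le ((walshBasis 𝕜).repr.symm c) (T ((walshBasis 𝕜).repr.symm c))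
    rw [norm_sub_rev, hc] at h2
    linarith
  · have h2 := norm_sub_norm_le (T ((walshBasis 𝕜).repr.symm c)) ((walshBasis 𝕜).repr.symm c)
    rw [hc] at h2
    linarith

end RieszBasis

/-! ### Splines -/

/-- The functions `W_1^j ρ_m`; they are multiples of derivatives of the spline `W_1 ρ_{m'}` with
`m' = m + j - 1`. -/
noncomputable def splineDeriv (m j : ℕ) : ℝ → ℝ := (opW true)^[j] (rho m)

theorem splineDeriv_succ (m j : ℕ) : splineDeriv m (j + 1) = opW true (splineDeriv m j) := by
  unfold splineDeriv
  rw [Function.iterate_succ_apply']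

theorem splineDeriv_periodic_bddMeas (m j : ℕ) :
    Function.Periodic (splineDeriv m j) 1 ∧ BddMeas (splineDeriv m j) := by
  induction j with
  | zero => exact ⟨rho_periodic m, BddMeas.rho m⟩
  | succ j ih =>
    rw [splineDeriv_succ]
    exact ⟨opW_periodic true ih.1, ih.2.opW true⟩

theorem integral_splineDeriv_succ (m j : ℕ) :
    ∫ t in (0 : ℝ)..1, splineDeriv m (j + 1) t = 0 := by
  obtain ⟨hp, hb⟩ := splineDeriv_periodic_bddMeas m j
  rw [splineDeriv_succ, integral_opW true hp hb, if_pos rfl]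

/-- Moving V in W_1^j (4 V W_1) ρ_m to the front past j operators W_1 costs the factor 2^j. -/
theorem splineDeriv_eq_volterra (m j : ℕ) (t : ℝ) :
    splineDeriv (m + 1) j t = 2 ^ (j + 2) * volterra (splineDeriv m (j + 1)) t := by
  induction j generalizing t with
  | zero =>
    have : splineDeriv m (0 + 1) = opW true (rho m) := splineDeriv_succ m 0
    rw [this]
    change rho (m + 1) t = _
    rw [rho_succ]
    norm_num
  | succ j ih =>
    obtain ⟨hp, hb⟩ := splineDeriv_periodic_bddMeas m (j + 1)
    rw [splineDeriv_succ, splineDeriv_succ m (j + 1),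
      volterra_opW true hp hb (integral_splineDeriv_succ m j)]
    simp only [opW, ih]
    ring

theorem continuous_splineDeriv_succ (m j : ℕ) : Continuous (splineDeriv (m + 1) j) := by
  have h : splineDeriv (m + 1) j = fun t => 2 ^ (j + 2) * volterra (splineDeriv m (j + 1)) t :=
    funext fun t => splineDeriv_eq_volterra m j t
  rw [h]
  exact continuous_const.mul (continuous_volterra (splineDeriv_periodic_bddMeas m (j + 1)).2)

theorem hasDerivAt_splineDeriv (m j : ℕ) {t : ℝ}
    (hc : ContinuousAt (splineDeriv m (j + 1)) t) :
    HasDerivAt (splineDeriv (m + 1) j) (2 ^ (j + 2) * splineDeriv m (j + 1) t) t := by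
  have h : splineDeriv (m + 1) j = fun t => 2 ^ (j + 2) * volterra (splineDeriv m (j + 1)) t :=
    funext fun t => splineDeriv_eq_volterra m j t
  have hb := (splineDeriv_periodic_bddMeas m (j + 1)).2
  rw [h]
  exact (intervalIntegral.integral_hasDerivAt_right (hb.intervalIntegrable 0 t)
    hb.1.stronglyMeasurable.stronglyMeasurableAtFilter hc).const_mul _

theorem deriv_splineDeriv (m j : ℕ) :
    deriv (splineDeriv (m + 2) j) = fun t => 2 ^ (j + 2) * splineDeriv (m + 1) (j + 1) t :=
  funext fun _ =>
    (hasDerivAt_splineDeriv (m + 1) j (continuous_splineDeriv_succ m (j + 1)).continuousAt).deriv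

theorem contDiff_splineDeriv (n m j : ℕ) :
    ContDiff ℝ (n : WithTop ℕ∞) (splineDeriv (m + n + 1) j) := by
  induction n generalizing j with
  | zero => exact contDiff_zero.mpr (continuous_splineDeriv_succ m j)
  | succ n ih =>
    push_cast
    rw [contDiff_succ_iff_deriv]
    refine ⟨fun t => (hasDerivAt_splineDeriv (m + n + 1) j
      (continuous_splineDeriv_succ (m + n) (j + 1)).continuousAt).differentiableAt, by simp, ?_⟩
    have h := deriv_splineDeriv (m + n) j
    rw [show m + (n + 1) + 1 = m + n + 2 by ring, h]
    exact contDiff_const.mul (ih (j + 1))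

theorem iteratedDeriv_splineDeriv (n m j : ℕ) : iteratedDeriv n (splineDeriv (m + n + 1) j) =
    fun t => (∏ i ∈ Finset.range n, (2 : ℝ) ^ (j + i + 2)) * splineDeriv (m + 1) (j + n) t := by
  induction n generalizing m with
  | zero => simp
  | succ n ih =>
    rw [iteratedDeriv_succ, show m + (n + 1) + 1 = m + 1 + n + 1 by ring, ih (m + 1)]
    ext t
    have h := hasDerivAt_splineDeriv (m + 1) (j + n)
      (continuous_splineDeriv_succ m (j + n + 1)).continuousAt (t := t)
    rw [(h.const_mul _).deriv, Finset.prod_range_succ]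
    ring_nf

theorem splineDeriv_zero_eq_prod (j : ℕ) (t : ℝ) :
    splineDeriv 0 j t = ∏ k ∈ Finset.range j, rademacher k t := by
  induction j generalizing t with
  | zero => simp [splineDeriv, rho]
  | succ j ih =>
    rw [splineDeriv_succ, Finset.prod_range_succ']
    simp only [opW, ih, rademacher_succ, rademacher_zero]
    ring

theorem continuousAt_rad {t : ℝ} (ht : ∀ j : ℤ, t ≠ j / 2) : ContinuousAt rad t := by
  have h0 : Real.sin (2 * Real.pi * t) ≠ 0 := fun h => by
    obtain ⟨j, hj⟩ := Real.sin_eq_zero_iff.mp h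
    refine ht j (mul_left_cancel₀ Real.pi_pos.ne' ?_)
    linarith
  have hc : Continuous fun t : ℝ => Real.sin (2 * Real.pi * t) := by fun_prop
  rcases lt_or_gt_of_ne h0 with h | h
  · refine (continuousAt_const (y := (-1 : ℝ))).congr ?_
    filter_upwards [hc.continuousAt.eventually_lt_const h] with s hs
    exact (Real.sign_of_neg hs).symm
  · refine (continuousAt_const (y := (1 : ℝ))).congr ?_
    filter_upwards [hc.continuousAt.eventually_const_lt h] with s hs
    exact (Real.sign_of_pos hs).symm

theorem continuousAt_rademacher {m k : ℕ} (hk : k ≤ m) {t : ℝ}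
    (ht : ∀ j : ℤ, t ≠ j / 2 ^ (m + 1)) : ContinuousAt (rademacher k) t := by
  have h : ContinuousAt rad (2 ^ k * t) := by
    refine continuousAt_rad fun j hj => ht (j * 2 ^ (m - k)) ?_
    have e : (2 : ℝ) ^ m = 2 ^ k * 2 ^ (m - k) := by rw [← pow_add]; congr 1; omega
    push_cast
    rw [pow_succ, e]
    field_simp
    field_simp at hj
    linarith
  exact h.comp (f := fun t : ℝ => 2 ^ k * t) (by fun_prop)

theorem prod_two_pow (m : ℕ) :
    ∏ i ∈ Finset.range m, (2 : ℝ) ^ (1 + i + 2) = 2 ^ (m * (m + 5) / 2) := by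
  rw [Finset.prod_pow_eq_pow_sum]
  congr 1
  -- The successive derivatives of W_1 ρ_m contribute the exponents 3, 4, …, m + 2.
  have h : (∑ i ∈ Finset.range m, (1 + i + 2)) * 2 = m * (m + 5) := by
    induction m with
    | zero => rfl
    | succ m ih =>
      rw [Finset.sum_range_succ, add_mul, ih]
      ring
  omega

theorem splineDeriv_apply_zero (m j : ℕ) : splineDeriv m (j + 1) 0 = 0 := by
  rw [splineDeriv_succ]
  simp [opW, rad_zero]

theorem isSpline_opW_rho {m : ℕ} (hm : 1 ≤ m) : IsSpline m (opW true (rho m)) := by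
  obtain ⟨m, rfl⟩ := Nat.exists_eq_add_of_le' hm
  have hS : opW true (rho (m + 1)) = splineDeriv (m + 1) 1 := rfl
  rw [hS]
  refine ⟨(splineDeriv_periodic_bddMeas _ _).1, ?_, fun t ht => ?_, fun μ hμ => ?_⟩
  · have h := contDiff_splineDeriv m 0 1
    rwa [zero_add] at h
  · have hc : ContinuousAt (splineDeriv 0 (1 + m + 1)) t := by
      have : splineDeriv 0 (1 + m + 1) = fun t => ∏ k ∈ Finset.range (1 + m + 1), rademacher k t :=
        funext fun t => splineDeriv_zero_eq_prod _ t
      rw [this]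
      refine tendsto_finsetProd _ fun k hk => ?_
      exact continuousAt_rademacher (by rw [Finset.mem_range] at hk; omega) ht
    have h := (hasDerivAt_splineDeriv 0 (1 + m) hc).const_mul
      (∏ i ∈ Finset.range m, (2 : ℝ) ^ (1 + i + 2))
    have hd := iteratedDeriv_splineDeriv m 0 1
    rw [zero_add, zero_add] at hd
    rw [zero_add, ← mul_assoc, ← Finset.prod_range_succ, prod_two_pow (m + 1), splineDeriv_zero_eq_prod,
      ← hd, show 1 + m + 1 = m + 1 + 1 by ring] at h
    exact h
  · obtain ⟨n, rfl⟩ : ∃ n, m = n + μ := ⟨m - μ, by omega⟩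
    rw [iteratedDeriv_splineDeriv, add_comm 1 μ]
    simp only [splineDeriv_apply_zero, mul_zero]

theorem eq_of_hasDerivAt_sub_off_countable {f g : ℝ → ℝ} (hf : Continuous f) (hg : Continuous g)
    {s : Set ℝ} (hs : s.Countable)
    (hd : ∀ t, t ∉ s → ∃ d, HasDerivAt f d t ∧ HasDerivAt g d t) (h0 : f 0 = g 0) : f = g := by
  ext t
  have h := MeasureTheory.integral_eq_of_hasDerivAt_off_countable (fun t => f t - g t)
    (fun _ => (0 : ℝ)) (a := 0) (b := t) hs (hf.sub hg).continuousOn (fun x hx => by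
      obtain ⟨d, h1, h2⟩ := hd x hx.2
      simpa using h1.fun_sub h2) (by simp)
  simp only [intervalIntegral.integral_zero] at h
  linarith

/-- Integrate downwards from order m - 1: two continuous functions with equal derivatives off a
countable set and equal values at 0 coincide. -/
theorem IsSpline.unique {m : ℕ} (hm : 1 ≤ m) {ψ φ : ℝ → ℝ} (hψ : IsSpline m ψ)
    (hφ : IsSpline m φ) : ψ = φ := by
  have key : ∀ i, i ≤ m - 1 → iteratedDeriv (m - 1 - i) ψ = iteratedDeriv (m - 1 - i) φ := by
    intro i hi
    have hcont : ∀ {χ : ℝ → ℝ}, IsSpline m χ → Continuous (iteratedDeriv (m - 1 - i) χ) :=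
      fun h => h.contDiff.continuous_iteratedDeriv _ (by exact_mod_cast Nat.sub_le _ _)
    have h0 : iteratedDeriv (m - 1 - i) ψ 0 = iteratedDeriv (m - 1 - i) φ 0 := by
      rw [hψ.init_eq _ (by omega), hφ.init_eq _ (by omega)]
    induction i with
    | zero =>
      refine eq_of_hasDerivAt_sub_off_countable (hcont hψ) (hcont hφ) countable_dyadic
        (fun t ht => ?_) h0
      have ht' : ∀ j : ℤ, t ≠ j / 2 ^ (m + 1) := fun j hj => ht ⟨m + 1, j, hj⟩
      exact ⟨_, hψ.deriv_eq t ht', hφ.deriv_eq t ht'⟩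
    | succ i ih =>
      have h1 : iteratedDeriv (m - 1 - i) ψ = iteratedDeriv (m - 1 - i) φ := by
        refine ih (by omega) (fun h => h.contDiff.continuous_iteratedDeriv _
          (by exact_mod_cast Nat.sub_le _ _)) ?_
        rw [hψ.init_eq _ (by omega), hφ.init_eq _ (by omega)]
      have hdiff : ∀ {χ : ℝ → ℝ}, IsSpline m χ →
          Differentiable ℝ (iteratedDeriv (m - 1 - (i + 1)) χ) :=
        fun h => h.contDiff.differentiable_iteratedDeriv _
          (by exact_mod_cast (by omega : m - 1 - (i + 1) < m - 1))
      have hsucc : ∀ χ : ℝ → ℝ, deriv (iteratedDeriv (m - 1 - (i + 1)) χ) =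
          iteratedDeriv (m - 1 - i) χ := fun χ => by
        rw [← iteratedDeriv_succ, show m - 1 - (i + 1) + 1 = m - 1 - i by omega]
      refine eq_of_hasDerivAt_sub_off_countable (hcont hψ) (hcont hφ) Set.countable_empty
        (fun t _ => ⟨iteratedDeriv (m - 1 - i) φ t, ?_, ?_⟩) h0
      · have h := (hdiff hψ t).hasDerivAt
        rwa [hsucc, h1] at h
      · have h := (hdiff hφ t).hasDerivAt
        rwa [hsucc] at h
  have h := key (m - 1) le_rfl
  simpa using h

/-! ### Words and Paley numbers -/

theorem paleyNumber_cons (a : Bool) (α : List Bool) :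
    paleyNumber (a :: α) = Nat.bit a (paleyNumber α) := by
  have h : paleyNumber (a :: α) = a.toNat +
      (∑ ν : Fin α.length, (α.get ν).toNat * 2 ^ ((ν : ℕ) + 1)) + 2 ^ (α.length + 1) := by
    change (∑ ν : Fin (α.length + 1), ((a :: α).get ν).toNat * 2 ^ (ν : ℕ)) + _ = _
    rw [Fin.sum_univ_succ]
    simp
  rw [h, Nat.bit_val]
  unfold paleyNumber
  simp only [pow_succ, ← mul_assoc, ← Finset.sum_mul]
  ring

theorem paleyNumber_nil : paleyNumber [] = 1 := by simp [paleyNumber]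

theorem paleyNumber_ne_zero (α : List Bool) : paleyNumber α ≠ 0 := by
  unfold paleyNumber
  positivity

theorem paleyNumber_injective : Function.Injective paleyNumber := by
  have hone : ∀ a α, paleyNumber (a :: α) ≠ 1 := fun a α h => by
    have := paleyNumber_ne_zero α
    rw [paleyNumber_cons, Nat.bit_val] at h
    omega
  intro α
  induction α with
  | nil =>
    intro β h
    cases β with
    | nil => rfl
    | cons b β => exact absurd (h.symm.trans paleyNumber_nil) (hone b β)
  | cons a α ih =>
    intro β h
    cases β with
    | nil => exact absurd (h.trans paleyNumber_nil) (hone a α)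
    | cons b β =>
      rw [paleyNumber_cons, paleyNumber_cons] at h
      have h1 := congrArg Nat.bodd h
      have h2 := congrArg Nat.div2 h
      rw [Nat.bodd_bit, Nat.bodd_bit] at h1
      rw [Nat.div2_bit, Nat.div2_bit] at h2
      rw [h1, ih h2]

theorem exists_paleyNumber_eq {n : ℕ} (hn : n ≠ 0) : ∃ α, paleyNumber α = n := by
  induction n using Nat.binaryRec with
  | zero => exact absurd rfl hn
  | bit a n ih =>
    by_cases h0 : n = 0
    · subst h0
      cases a
      · exact absurd rfl hn
      · exact ⟨[], paleyNumber_nil⟩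
    · obtain ⟨α, rfl⟩ := ih h0
      exact ⟨a :: α, paleyNumber_cons a α⟩

/-- The bijection of finite words in `0`, `1` with the positive integers. -/
noncomputable def paleyEquiv : List Bool ≃ {n : ℕ // 1 ≤ n} :=
  Equiv.ofBijective
    (fun α => ⟨paleyNumber α, Nat.one_le_iff_ne_zero.mpr (paleyNumber_ne_zero α)⟩)
    ⟨fun _ _ h => paleyNumber_injective (congrArg Subtype.val h), fun n => by
      obtain ⟨α, hα⟩ := exists_paleyNumber_eq (Nat.one_le_iff_ne_zero.mp n.2)
      exact ⟨α, Subtype.ext hα⟩⟩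

theorem paleyEquiv_apply (α : List Bool) : (paleyEquiv α : ℕ) = paleyNumber α := rfl

theorem opWord_opW_rho (m : ℕ) (α : List Bool) :
    opWord α (opW true (rho m)) = wavelet m (paleyNumber α) := by
  induction α with
  | nil =>
    rw [paleyNumber_nil, wavelet_one]
    rfl
  | cons a α ih =>
    rw [paleyNumber_cons, wavelet_bit m a (paleyNumber_ne_zero α), ← ih]
    rfl

end WalshWavelet

theorem mainTheorem3 (𝕜 : Type*) [RCLike 𝕜] :
    (∀ m : ℕ, 3 ≤ m → WalshWavelet.IsRieszBasis 𝕜 (WalshWavelet.waveletL2 𝕜 m)) ∧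
    (∃ A B : ℝ, ∀ m : ℕ, 1 ≤ m →
      WalshWavelet.IsRieszBounds 𝕜 A B (WalshWavelet.waveletL2 𝕜 m)) ∧
    (∀ m : ℕ, 1 ≤ m →
      (∃ ψ : ℝ → ℝ, WalshWavelet.IsSpline m ψ) ∧
      ∀ ψ : ℝ → ℝ, WalshWavelet.IsSpline m ψ →
        ∃ e : List Bool ≃ {n : ℕ // 1 ≤ n}, ∀ α : List Bool,
          (e α : ℕ) = WalshWavelet.paleyNumber α ∧
          WalshWavelet.opWord α ψ = WalshWavelet.wavelet m (e α)) := by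
  refine ⟨fun m hm => WalshWavelet.isRieszBasis_waveletL2 𝕜 (le_trans (by norm_num) hm),
    ⟨1 / 1000, 1999 / 1000, fun m hm => WalshWavelet.isRieszBounds_waveletL2 𝕜 hm⟩,
    fun m hm => ⟨⟨_, WalshWavelet.isSpline_opW_rho hm⟩, fun ψ hψ => ⟨WalshWavelet.paleyEquiv,
      fun α => ⟨WalshWavelet.paleyEquiv_apply α, ?_⟩⟩⟩⟩
  rw [hψ.unique hm (WalshWavelet.isSpline_opW_rho hm), WalshWavelet.opWord_opW_rho,
    WalshWavelet.paleyEquiv_apply]
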